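/- **Setting.** Let $n,d,C\ge 0$ be integers and let $U$ be a set of (source) domains. A *model* consists of: a directed acyclic graph $\mathcal G$ on the variables $Z_1,\dots,Z_n$ (real) and $Y$ (with values in $\{v_1,\dots,v_C\}$); mutually independent noise variables $\epsilon_1,\dots,\epsilon_n,\epsilon_Y$; measurable structural functions with domain-dependent parameters, so that in each domain $u\in U$ $$Z_i=f_i(\mathrm{PA}(Z_i;\mathcal G),\epsilon_i;\theta^{(u)}_i)\ (i=1,\dots,n),\qquad Y=f_Y(\mathrm{PA}(Y;\mathcal G),\epsilon_Y;\theta^{(u)}_Y);$$ and a mixing function $g:\mathbb R^n\to\mathbb R^d$, the same in all domains, which is a $C^\infty$ injection whose inverse on its image is $C^\infty$; the features are $X=g(Z)$. It is assumed that in every domain the pair $(Z,Y)$ has a joint density $P^{(u)}(z,c)$ (with respect to Lebesgue measure times counting measure on the labels) that is strictly positive for all $z\in\mathbb R^n$ and all labels $c$, and three times differentiable in $z$. The model is *faithful* if in every domain each conditional independence $A\perp B\mid S$ (with $A,B,S$ pairwise disjoint sets of variables) under the law of $(Z,Y)$ implies that $A$ and $B$ are d-separated by $S$ in $\mathcal G$.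 The *Markov network* $\mathcal M$ is the undirected graph on $Z_1,\dots,Z_n,Y$ in which two distinct variables are non-adjacent exactly when they are conditionally independent given all the other variables (in all domains). The *Markov blanket* $Z_{\mathrm{MB}}$ is the set of those latent variables that are parents, children or spouses of $Y$ in $\mathcal G$. The *intimate neighbors* $\Psi_{Z_i}$ of $Z_i$ are the latent variables $Z_j$ adjacent in $\mathcal M$ to $Z_i$ and to all other neighbors of $Z_i$ in $\mathcal M$ ($Y$ included). **Sufficient changes for $Z$.** Let $m$ be the number of edges of $\mathcal M$ between two latent variables. For every $z\in\mathbb R^n$ there are a label $c$ and domains $u_0,\dots,u_{2n+m}$ such that the $2n+m$ vectors $w(z,c,u_k)-w(z,c,u_0)$, $k=1,\dots,2n+m$, are linearly independent, where $$w(z,c,u)=\Big(\tfrac{\partial \log P^{(u)}(z,c)}{\partial z_i}\Big)_{i}\oplus\Big(\tfrac{\partial^2 \log P^{(u)}(z,c)}{\partial z_i^2}\Big)_{i}\oplus\Big(\tfrac{\partial^2 \log P^{(u)}(z,c)}{\partial z_i\partial z_j}\Big)_{\{Z_i,Z_j\}\in\mathcal E(\mathcal M),\ i<j}.$$ **Sufficient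 changes for $Y$.** For every $z\in\mathbb R^n$ there are a label $c_1$ and pairs $(u_k,c_k)$, $k=1,\dots,|Z_{\mathrm{MB}}|$, with $c_k\ne c_1$, such that the vectors $\tau(z,u_k,c_k)-\tau(z,u_k,c_1)$ are linearly independent, where $\tau(z,u,c)=\big(\tfrac{\partial\log P^{(u)}(z,c)}{\partial z_i}\big)_{Z_i\in Z_{\mathrm{MB}}}$. **Learned model.** Let a faithful model satisfying both sufficient-change conditions be given (the true model). Call a faithful model with the same $n,d,C,U$ *admissible* if its mixing function has the same image as $g$ and it has the same law of $(X,Y)$ as the true model in every domain. Let the learned model, with objects $\hat g,\hat{\mathcal G},\hat{\mathcal M},\hat Z_{\mathrm{MB}}$ and learned latents $\hat Z=\hat g^{-1}(X)=\hat g^{-1}(g(Z))$, be an admissible model whose Markov network has the smallest number of edges among all admissible models. **Theorem (subspace identifiability of the Markov blanket).** There is a permutation $\pi$ of $\{1,\dots,n\}$ such that: 1. $Z_i\mapsto\hat Z_{\pi(i)}$, $Y\mapsto Y$ is a graph isomorphism from $\mathcal M$ onto $\hat{\mathcal M}$, and $Z_i\in Z_{\mathrm{MB}}$ if and only if $\hat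 Z_{\pi(i)}\in\hat Z_{\mathrm{MB}}$; 2. for every $i$, $\hat Z_{\pi(i)}$ is a function only of $Z_i$ and its intimate neighbors $\Psi_{Z_i}$. Moreover, $\hat Z_{\mathrm{MB}}$ is an invertible transformation of $Z_{\mathrm{MB}}$: there is a bijection $\Phi$ from $\mathbb R^{Z_{\mathrm{MB}}}$ onto $\mathbb R^{\hat Z_{\mathrm{MB}}}$, smooth with smooth inverse, with $\hat Z_{\mathrm{MB}}=\Phi(Z_{\mathrm{MB}})$. -/

import Mathlib

open MeasureTheory ProbabilityTheory
open scoped ContDiff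

namespace MBIdent

/-! ### Variables and assignments -/

/-- The variables of the structural equation model: `some i` is the latent variable `Z_i`,
`none` is the label `Y`. -/
abbrev Node (n : ℕ) : Type := Option (Fin n)

/-- The range of a variable: a latent variable is real, the label takes one of `C` values. -/
abbrev Val (n C : ℕ) : Node n → Type
  | none => Fin C
  | some _ => ℝ

instance instMeasurableSpaceVal (n C : ℕ) : ∀ v : Node n, MeasurableSpace (Val n C v)
  | none => inferInstanceAs (MeasurableSpace (Fin C))
  | some _ => inferInstanceAs (MeasurableSpace ℝ)

instance instStandardBorelSpaceVal (n C : ℕ) : ∀ v : Node n, StandardBorelSpace (Val n C v)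
  | none => inferInstanceAs (StandardBorelSpace (Fin C))
  | some _ => inferInstanceAs (StandardBorelSpace ℝ)

/-- A joint value of all the variables `(Z, Y)`. -/
abbrev Asg (n C : ℕ) : Type := ∀ v : Node n, Val n C v

/-- The value of the latent vector `Z`. -/
def latent {n C : ℕ} (x : Asg n C) : Fin n → ℝ := fun i => x (some i)

/-- The value of the label `Y`. -/
def label {n C : ℕ} (x : Asg n C) : Fin C := x none

/-! ### Directed graphs and d-separation -/

/-- A directed graph without directed cycles. -/
def IsDAG {V : Type*} (G : Digraph V) : Prop := ∀ v, ¬ Relation.TransGen G.Adj v v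

/-- The `k`-th vertex of a path is a collider: both path edges at it point into it. -/
def IsCollider {V : Type*} (G : Digraph V) {a b : V}
    (p : G.toSimpleGraphInclusive.Walk a b) (k : ℕ) : Prop :=
  G.Adj (p.getVert (k - 1)) (p.getVert k) ∧ G.Adj (p.getVert (k + 1)) (p.getVert k)

/-- A path of the skeleton is active given `S` if each interior collider has a descendant
(possibly itself) in `S`, and no other interior vertex is in `S`. -/
def IsActive {V : Type*} (G : Digraph V) (S : Set V) {a b : V}
    (p : G.toSimpleGraphInclusive.Walk a b) : Prop :=
  ∀ k, 0 < k → k < p.length →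
    (IsCollider G p k → ∃ s ∈ S, Relation.ReflTransGen G.Adj (p.getVert k) s) ∧
    (¬ IsCollider G p k → p.getVert k ∉ S)

/-- `A` and `B` are d-separated by `S`. -/
def DSep {V : Type*} (G : Digraph V) (A B S : Set V) : Prop :=
  ∀ a ∈ A, ∀ b ∈ B, ∀ p : G.toSimpleGraphInclusive.Walk a b, p.IsPath → ¬ IsActive G S p

/-- The Markov blanket of the label: its parents, its children, and its spouses (the other
parents of its children). -/
noncomputable def labelBlanket {n : ℕ} (G : Digraph (Node n)) : Finset (Fin n) :=
  open Classical in
  Finset.univ.filter fun i =>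
    G.Adj (some i) none ∨ G.Adj none (some i) ∨ ∃ k, G.Adj none k ∧ G.Adj (some i) k

/-! ### Conditional independence -/

/-- Under the law `P` of `(Z, Y)`, the variables in `A` and those in `B` are conditionally
independent given those in `S`. -/
def CondIndepVars {n C : ℕ} (P : Measure (Asg n C)) [IsFiniteMeasure P]
    (A B S : Set (Node n)) : Prop :=
  CondIndepFun (MeasurableSpace.comap (S.domRestrict : Asg n C → _) MeasurableSpace.pi)
    (Set.measurable_restrict S).comap_le
    (A.domRestrict : Asg n C → _) (B.domRestrict : Asg n C → _) P

/-! ### Differentiation -/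

/-- The partial derivative in the `i`-th coordinate. -/
noncomputable def partialDeriv {n : ℕ} (i : Fin n) (f : (Fin n → ℝ) → ℝ) : (Fin n → ℝ) → ℝ :=
  fun z => fderiv ℝ f z (Pi.single i 1)

/-- `f` is three times differentiable. -/
def ThriceDifferentiable {n : ℕ} (f : (Fin n → ℝ) → ℝ) : Prop :=
  Differentiable ℝ f ∧ Differentiable ℝ (fderiv ℝ f) ∧
    Differentiable ℝ (fderiv ℝ (fderiv ℝ f))

/-- `g` is a smooth injection whose inverse on its image is smooth. -/
structure IsSmoothInvertible {n d : ℕ} (g : (Fin n → ℝ) → (Fin d → ℝ)) : Prop where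
  contDiff : ContDiff ℝ ∞ g
  injective : Function.Injective g
  contDiffOn_inv : ContDiffOn ℝ ∞ (Function.invFun g) (Set.range g)

/-! ### The generative process -/

/-- The generative process with `n` latent variables, `d` features, `C` label values, and
domains `U`: a structural equation model over `(Z, Y)` on one DAG, whose parameters depend on the
domain, with mutually independent noise variables, together with a mixing function. -/
structure Model (n d C : ℕ) (U : Type*) where
  /-- the causal graph -/
  graph : Digraph (Node n)
  isDAG : IsDAG graph
  /-- the spaces in which the exogenous noise variables take their values -/
  Noise : Node n → Type
  instNoise : ∀ v, MeasurableSpace (Noise v)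
  /-- the distributions of the noise variables -/
  noiseLaw : ∀ v, Measure (Noise v)
  instNoiseLaw : ∀ v, IsProbabilityMeasure (noiseLaw v)
  /-- the spaces of parameters of the structural equations -/
  Param : Node n → Type
  /-- the parameters in each domain -/
  param : U → ∀ v, Param v
  /-- the structural functions: parents, noise, parameter -/
  mech : ∀ v, (∀ w : {w // graph.Adj w v}, Val n C w) → Noise v → Param v → Val n C v
  measurable_mech : ∀ v θ, Measurable fun q : (∀ w : {w // graph.Adj w v}, Val n C w) × Noise v =>
    mech v q.1 q.2 θ
  /-- the variables `(Z, Y)` in each domain, as functions of the noise -/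
  vars : U → (∀ v, Noise v) → Asg n C
  measurable_vars : ∀ u, Measurable (vars u)
  /-- the structural equations -/
  vars_eq : ∀ u e v, vars u e v = mech v (fun w => vars u e w) (e v) (param u v)
  /-- the density of `(Z, Y)` in each domain -/
  density : U → (Fin n → ℝ) → Fin C → ℝ
  density_pos : ∀ u z c, 0 < density u z c
  density_diff : ∀ u c, ThriceDifferentiable fun z => density u z c
  /-- the density is that of the joint law of `(Z, Y)`; the noise variables are mutually
  independent, that is, their joint law is the product -/
  density_eq : ∀ u,
    ((Measure.pi noiseLaw).map (vars u)).map (fun x => (latent x, label x)) =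
      ((volume : Measure (Fin n → ℝ)).prod (Measure.count : Measure (Fin C))).withDensity
        fun q => ENNReal.ofReal (density u q.1 q.2)
  /-- the mixing function, the same in all domains -/
  mix : (Fin n → ℝ) → (Fin d → ℝ)
  mix_smooth : IsSmoothInvertible mix

namespace Model

variable {n d C : ℕ} {U : Type*} (M : Model n d C U)

attribute [instance] Model.instNoise Model.instNoiseLaw

/-- The joint law of `(Z, Y)` in domain `u`. -/
noncomputable def law (u : U) : Measure (Asg n C) := (Measure.pi M.noiseLaw).map (M.vars u)

instance instIsFiniteMeasureLaw (u : U) : IsFiniteMeasure (M.law u) := by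
  unfold law; infer_instance

/-- The joint law of the observed pair `(X, Y)`, `X = g(Z)`, in domain `u`. -/
noncomputable def obsLaw (u : U) : Measure ((Fin d → ℝ) × Fin C) :=
  (M.law u).map fun x => (M.mix (latent x), label x)

/-- Faithfulness: in every domain, every conditional independence among the variables is entailed
by d-separation in the causal graph. -/
def Faithful : Prop :=
  ∀ u, ∀ A B S : Set (Node n), Disjoint A B → Disjoint A S → Disjoint B S →
    CondIndepVars (M.law u) A B S → DSep M.graph A B S

/-- The Markov network over `(Z, Y)`: two variables are not adjacent if and only if they are
conditionally independent given all the other variables (in all domains). -/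
def markovNet : SimpleGraph (Node n) where
  Adj a b := a ≠ b ∧ ∃ u, ¬ CondIndepVars (M.law u) {a} {b} {a, b}ᶜ
  symm := ⟨by
    rintro a b ⟨hab, u, hu⟩
    refine ⟨hab.symm, u, fun h => hu ?_⟩
    have h2 : CondIndepVars (M.law u) {a} {b} {b, a}ᶜ := CondIndepFun.symm h
    rwa [Set.pair_comm b a] at h2⟩
  loopless := ⟨fun _ h => h.1 rfl⟩

/-- The number of edges of the Markov network. -/
noncomputable def numEdges : ℕ := M.markovNet.edgeSet.ncard

/-- The Markov blanket of the label, as a set of latent variables. -/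
noncomputable def blanket : Finset (Fin n) := labelBlanket M.graph

/-- The edges of the Markov network between two latent variables. -/
abbrev LatentEdge : Type :=
  {e : Fin n × Fin n // e.1 < e.2 ∧ M.markovNet.Adj (some e.1) (some e.2)}

/-- The intimate neighbors of `Z_i`: the latent variables adjacent in the Markov network to `Z_i`
and to all other neighbors of `Z_i` (the label included). -/
def intimate (i : Fin n) : Set (Fin n) :=
  {j | M.markovNet.Adj (some j) (some i) ∧
    ∀ w, M.markovNet.Adj (some i) w → w ≠ some j → M.markovNet.Adj (some j) w}

/-- The logarithm of the density of `(Z, Y)` at `Y = v_c`, as a function of `Z`. -/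
noncomputable def logDensity (u : U) (c : Fin C) : (Fin n → ℝ) → ℝ :=
  fun z => Real.log (M.density u z c)

/-- The vector of the first derivatives, the pure second derivatives, and the mixed second
derivatives along the edges between latent variables, of the log-density. -/
noncomputable def wVec (z : Fin n → ℝ) (c : Fin C) (u : U) :
    Fin n ⊕ Fin n ⊕ M.LatentEdge → ℝ
  | .inl i => partialDeriv i (M.logDensity u c) z
  | .inr (.inl i) => partialDeriv i (partialDeriv i (M.logDensity u c)) z
  | .inr (.inr e) => partialDeriv e.1.2 (partialDeriv e.1.1 (M.logDensity u c)) z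

/-- Sufficient changes for `Z`. -/
def SufficientChangesZ : Prop :=
  ∀ z : Fin n → ℝ, ∃ c : Fin C, ∃ u : Fin (2 * n + Nat.card M.LatentEdge + 1) → U,
    LinearIndependent ℝ fun k : Fin (2 * n + Nat.card M.LatentEdge) =>
      M.wVec z c (u k.succ) - M.wVec z c (u 0)

/-- The vector of the first derivatives of the log-density in the Markov blanket directions. -/
noncomputable def tauVec (z : Fin n → ℝ) (u : U) (c : Fin C) : M.blanket → ℝ :=
  fun i => partialDeriv i.1 (M.logDensity u c) z

/-- Sufficient changes for `Y`. -/
def SufficientChangesY : Prop :=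
  ∀ z : Fin n → ℝ, ∃ c₁ : Fin C, ∃ (u : Fin M.blanket.card → U) (c : Fin M.blanket.card → Fin C),
    (∀ k, c k ≠ c₁) ∧
    LinearIndependent ℝ fun k => M.tauVec z (u k) (c k) - M.tauVec z (u k) c₁

/-- Two models are observationally equivalent: their mixing functions have the same image (the
feature vectors on which the latent variables can be recovered), and the laws of `(X, Y)` agree in
every domain. -/
def ObsEquiv (M N : Model n d C U) : Prop :=
  Set.range M.mix = Set.range N.mix ∧ ∀ u, M.obsLaw u = N.obsLaw u

/-- `N` is a result of learning from the data of `M`: a faithful model of the same generative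
process that reproduces the observed laws, whose Markov network has the smallest number of edges
among all such models. -/
def IsLearned (M N : Model n d C U) : Prop :=
  N.Faithful ∧ ObsEquiv M N ∧
    ∀ N' : Model n d C U, N'.Faithful → ObsEquiv M N' → N.numEdges ≤ N'.numEdges

end Model

end MBIdent

set_option linter.unusedSectionVars false

/-! Write `k = transition L M`, the map from learned to true latents, and `J` for its Jacobian, so
that `J i a` is the derivative of the true `z_i` in the learned `ẑ_a`. Change of variables gives
`log p = log |det| + log p̂`, where the determinant depends neither on the domain nor on the label;
differences of log-densities over domains or labels are therefore the same functions for both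
models, up to composition with `k` (`logDensity_sub_eq`).

Conditional independence of two variables given the rest makes the density factor into a function
free of one and a function free of the other. Since the density is positive and continuous, this
becomes a cross-ratio identity at every point (`Separable.cross`), so that the mixed derivative of
the log-density vanishes along every non-edge between latents. If `a`, `b` are non-adjacent in the
learned network, differentiating domain differences in `ẑ_a` and `ẑ_b` gives zero. The chain rule
writes this as a linear relation on the vectors `w(u_k) - w(u_0)`, and sufficient changes kill its
coefficients. Hence `J i a * J j b = 0` whenever `i = j` or `i`, `j` are adjacent in the true
network (`jac_mul_jac_eq_zero`). Label differences likewise give `J i a = 0` for `i` in the true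
blanket and `a` outside the learned one (`jac_eq_zero`).

The rest is combinatorial. As `J` is invertible, a permutation `σ` has all `J (σ a) a ≠ 0`. Its
inverse sends edges to edges, so by minimality of the learned network it is an isomorphism. Then `J
i a ≠ 0` forces the closed neighborhood of `i` into that of `σ a`. This inclusion is a preorder, so
the inverse Jacobian is supported on it too (`rel_of_mul_eq_one`). The closed neighborhoods of the
`σ a` are locally constant in the point, hence constant, and a single permutation serves everywhere.
Vanishing partial derivatives finally integrate to independence of coordinates. Blanket membership
is adjacency to the label: one direction is faithfulness, the other the factorization of a
structural model along its DAG. -/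

namespace MBIdent

/-! ### Marginal densities and conditional kernels over a product probability measure. -/

section Averaging

open scoped ENNReal

variable {ι : Type*} [Fintype ι] [DecidableEq ι] {X : ι → Type*} [∀ i, MeasurableSpace (X i)]
  (ρ : ∀ i, Measure (X i)) [∀ i, IsProbabilityMeasure (ρ i)]

/-- The conditional expectation, under a product probability measure, given the coordinates
in `T`. -/
noncomputable def avg (T : Finset ι) (f : (∀ i, X i) → ℝ≥0∞) : (∀ i, X i) → ℝ≥0∞ :=
  lmarginal ρ Tᶜ f

theorem measurable_avg (T : Finset ι) {f : (∀ i, X i) → ℝ≥0∞} (hf : Measurable f) :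
    Measurable (avg ρ T f) := Measurable.lmarginal ρ hf

theorem dependsOn_avg (T : Finset ι) (f : (∀ i, X i) → ℝ≥0∞) :
    DependsOn (avg ρ T f) (T : Set ι) := fun x y h =>
  lmarginal_congr ρ f fun i hi => h i (by simpa using hi)

theorem DependsOn.mul {α : ι → Type*} {β : Type*} [Mul β] {f g : (∀ i, α i) → β} {s : Set ι}
    (hf : DependsOn f s) (hg : DependsOn g s) : DependsOn (f * g) s := fun x y h => by
  simp only [Pi.mul_apply, hf h, hg h]

theorem DependsOn.div {α : ι → Type*} {β : Type*} [Div β] {f g : (∀ i, α i) → β} {s : Set ι}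
    (hf : DependsOn f s) (hg : DependsOn g s) : DependsOn (f / g) s := fun x y h => by
  simp only [Pi.div_apply, hf h, hg h]

theorem avg_mul_of_dependsOn {T : Finset ι} {f g : (∀ i, X i) → ℝ≥0∞} (hf : Measurable f)
    (hg : DependsOn g (T : Set ι)) : avg ρ T (f * g) = avg ρ T f * g := by
  ext x
  simp only [avg, lmarginal, Pi.mul_apply]
  have hm : Measurable fun y => f (Function.updateFinset x Tᶜ y) :=
    hf.comp measurable_updateFinset
  rw [← lintegral_mul_const _ hm]
  refine lintegral_congr fun y => ?_
  rw [hg (x := Function.updateFinset x Tᶜ y) (y := x)]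
  intro i hi
  simp [Function.updateFinset, show i ∈ T from hi]

theorem avg_of_dependsOn {T : Finset ι} {g : (∀ i, X i) → ℝ≥0∞}
    (hg : DependsOn g (T : Set ι)) : avg ρ T g = g := by
  have h := avg_mul_of_dependsOn ρ (f := fun _ => 1) measurable_const hg
  have h1 : avg ρ T (fun _ => 1) = fun _ => 1 := by
    ext x; simp [avg, lmarginal]
  rw [h1] at h
  convert h using 1
  · congr 1; ext x; simp
  · ext x; simp

theorem lintegral_avg (T : Finset ι) {f : (∀ i, X i) → ℝ≥0∞} (hf : Measurable f) :
    ∫⁻ x, avg ρ T f x ∂Measure.pi ρ = ∫⁻ x, f x ∂Measure.pi ρ :=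
  lintegral_eq_of_lmarginal_eq Tᶜ (measurable_avg ρ T hf) hf
    (avg_of_dependsOn ρ (dependsOn_avg ρ T f))

theorem lintegral_mul_of_dependsOn {T : Finset ι} {f g : (∀ i, X i) → ℝ≥0∞} (hf : Measurable f)
    (hgm : Measurable g) (hg : DependsOn g (T : Set ι)) :
    ∫⁻ x, (f * g) x ∂Measure.pi ρ = ∫⁻ x, (avg ρ T f * g) x ∂Measure.pi ρ := by
  rw [← lintegral_avg ρ T (hf.mul hgm), avg_mul_of_dependsOn ρ hf hg]

/-- Averaging is self-adjoint: both sides equal the integral of the product of the two averages. -/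
theorem lintegral_mul_avg (T : Finset ι) {f g : (∀ i, X i) → ℝ≥0∞} (hf : Measurable f)
    (hg : Measurable g) :
    ∫⁻ x, (f * avg ρ T g) x ∂Measure.pi ρ = ∫⁻ x, (avg ρ T f * g) x ∂Measure.pi ρ := by
  rw [lintegral_mul_of_dependsOn ρ hf (measurable_avg ρ T hg) (dependsOn_avg ρ T g),
    mul_comm (avg ρ T f) g,
    lintegral_mul_of_dependsOn ρ hg (measurable_avg ρ T hf) (dependsOn_avg ρ T f), mul_comm]

/-- Resampling the coordinate `v` from a kernel. -/
noncomputable def resample {v : ι} (κ : Kernel (∀ i, X i) (X v)) (F : (∀ i, X i) → ℝ≥0∞)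
    (x : ∀ i, X i) : ℝ≥0∞ := ∫⁻ t, F (Function.update x v t) ∂κ x

theorem measurable_resample {v : ι} (κ : Kernel (∀ i, X i) (X v)) [IsSFiniteKernel κ]
    {F : (∀ i, X i) → ℝ≥0∞} (hF : Measurable F) : Measurable (resample κ F) := by
  unfold resample
  refine Measurable.lintegral_kernel_prod_right' (κ := κ)
    (f := fun q : (∀ i, X i) × X v => F (Function.update q.1 v q.2)) (hF.comp ?_)
  exact measurable_update'

theorem dependsOn_resample {v : ι} {κ : Kernel (∀ i, X i) (X v)} {W : Set ι}
    (hκ : DependsOn κ W) {F : (∀ i, X i) → ℝ≥0∞} {T : Set ι} (hW : W ⊆ T)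
    (hF : DependsOn F (insert v T)) : DependsOn (resample κ F) T := by
  intro x y h
  unfold resample
  rw [hκ (x := x) (y := y) fun i hi => h i (hW hi)]
  refine lintegral_congr fun t => hF fun i hi => ?_
  by_cases hiv : i = v
  · subst hiv; simp
  · simp only [Function.update_of_ne hiv]
    exact h i (hi.resolve_left hiv)

theorem resample_mul_of_dependsOn {v : ι} (κ : Kernel (∀ i, X i) (X v))
    {F g : (∀ i, X i) → ℝ≥0∞} (hF : Measurable F) {T : Set ι} (hv : v ∉ T) (hg : DependsOn g T) :
    resample κ (g * F) = g * resample κ F := by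
  ext x
  simp only [resample, Pi.mul_apply]
  have hm : Measurable fun t => F (Function.update x v t) := hF.comp (measurable_update x)
  rw [← lintegral_const_mul _ hm]
  refine lintegral_congr fun t => ?_
  congr 1
  refine hg fun i hi => ?_
  rw [Function.update_of_ne]
  rintro rfl
  exact hv hi

/-- The coordinates averaged out are neither `v` nor read by `κ`, so this is Tonelli. -/
theorem avg_resample {v : ι} (κ : Kernel (∀ i, X i) (X v)) [IsSFiniteKernel κ] {W : Finset ι}
    (hκ : DependsOn κ (W : Set ι)) {H : (∀ i, X i) → ℝ≥0∞} (hH : Measurable H) :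
    avg ρ (insert v W) (resample κ H) = resample κ (avg ρ (insert v W) H) := by
  ext x
  simp only [avg, lmarginal, resample]
  have key : ∀ y t, Function.update (Function.updateFinset x (insert v W)ᶜ y) v t =
      Function.updateFinset (Function.update x v t) (insert v W)ᶜ y := by
    intro y t
    ext i
    by_cases hiv : i = v
    · subst hiv; simp [Function.updateFinset]
    · simp [Function.updateFinset, Function.update_of_ne hiv]
  have hκ' : ∀ y, κ (Function.updateFinset x (insert v W)ᶜ y) = κ x := fun y =>
    hκ fun i hi => by simp [Function.updateFinset, show i ∈ W from hi]
  simp only [hκ', key]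
  rw [lintegral_lintegral_swap]
  refine Measurable.aemeasurable (hH.comp (f := fun q : (∀ i : ((insert v W)ᶜ : Finset ι), X i) × X v =>
    Function.updateFinset (Function.update x v q.2) (insert v W)ᶜ q.1) ?_)
  exact measurable_updateFinset'.comp (((measurable_update x).comp measurable_snd).prodMk measurable_fst)

theorem lintegral_resample_avg {v : ι} (κ : Kernel (∀ i, X i) (X v)) [IsSFiniteKernel κ]
    {W : Finset ι} (hκ : DependsOn κ (W : Set ι)) {H : (∀ i, X i) → ℝ≥0∞} (hH : Measurable H) :
    ∫⁻ x, resample κ (avg ρ (insert v W) H) x ∂Measure.pi ρ =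
      ∫⁻ x, resample κ H x ∂Measure.pi ρ := by
  rw [← avg_resample ρ κ hκ hH, lintegral_avg ρ _ (measurable_resample κ hH)]

/-- Together with `avg_ne_top_ae`, this allows cancelling a marginal density in `ℝ≥0∞`. -/
theorem avg_ne_zero (T : Finset ι) {f : (∀ i, X i) → ℝ≥0∞} (hf : Measurable f)
    (h0 : ∀ x, f x ≠ 0) (x : ∀ i, X i) : avg ρ T f x ≠ 0 := by
  simp only [avg, lmarginal]
  intro h
  have hm : Measurable fun y => f (Function.updateFinset x Tᶜ y) :=
    hf.comp measurable_updateFinset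
  rw [lintegral_eq_zero_iff hm] at h
  obtain ⟨y, hy⟩ := h.exists
  exact h0 _ hy

theorem avg_ne_top_ae (T : Finset ι) {f : (∀ i, X i) → ℝ≥0∞} (hf : Measurable f)
    (h1 : ∫⁻ x, f x ∂Measure.pi ρ ≠ ⊤) : ∀ᵐ x ∂Measure.pi ρ, avg ρ T f x ≠ ⊤ := by
  have := ae_lt_top (μ := Measure.pi ρ) (measurable_avg ρ T hf) (by rwa [lintegral_avg ρ T hf])
  exact this.mono fun x hx => hx.ne

/-- If, under the density `f`, the coordinate `v` has a conditional law given the coordinates in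
`T` that depends only on the coordinates in `W`, then the marginal density on `T ∪ {v}` is the
product of that on `T` and of a conditional density. -/
theorem avg_insert_ae_eq {f : (∀ i, X i) → ℝ≥0∞} (hf : Measurable f) (h0 : ∀ x, f x ≠ 0)
    (h1 : ∫⁻ x, f x ∂Measure.pi ρ ≠ ⊤) {v : ι} {W T : Finset ι} (hvT : v ∉ T) (hWT : W ⊆ T)
    (κ : Kernel (∀ i, X i) (X v)) [IsSFiniteKernel κ] (hκ : DependsOn κ (W : Set ι))
    (H : ∀ F : (∀ i, X i) → ℝ≥0∞, Measurable F → DependsOn F (insert v T : Finset ι) →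
      ∫⁻ x, (f * F) x ∂Measure.pi ρ = ∫⁻ x, (f * resample κ F) x ∂Measure.pi ρ) :
    avg ρ (insert v T) f =ᵐ[Measure.pi ρ]
      avg ρ T f * (avg ρ (insert v W) f / avg ρ W f) := by
  have hvW : v ∉ W := fun h => hvT (hWT h)
  have hcW : W ⊆ insert v W := Finset.subset_insert _ _
  have hcT : T ⊆ insert v T := Finset.subset_insert _ _
  have hcWT : insert v W ⊆ insert v T := Finset.insert_subset_insert _ hWT
  have mT := measurable_avg ρ T hf
  have mW := measurable_avg ρ W hf
  have mvW := measurable_avg ρ (insert v W) hf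
  have dT := dependsOn_avg ρ T f
  have dW := dependsOn_avg ρ W f
  have dvW := dependsOn_avg ρ (insert v W) f
  -- The kernel `κ` is not assumed to have a density. `H` is applied once to bring `κ` in; after the
  -- test function has been reduced to the coordinates `W ∪ {v}`, `H` is applied backwards to remove
  -- `κ`, leaving only marginals of `f`.
  have key : ∀ F : (∀ i, X i) → ℝ≥0∞, Measurable F →
      ∫⁻ x, (F * avg ρ (insert v T) f) x ∂Measure.pi ρ =
      ∫⁻ x, (F * (avg ρ T f * (avg ρ (insert v W) f / avg ρ W f))) x ∂Measure.pi ρ := by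
    intro F hF
    set F' := avg ρ (insert v T) F with hF'
    have mF' : Measurable F' := measurable_avg ρ _ hF
    have dF' : DependsOn F' (insert v T : Finset ι) := dependsOn_avg ρ _ F
    set G' := avg ρ (insert v W) (avg ρ T f * F') with hG'
    have mG' : Measurable G' := measurable_avg ρ _ (mT.mul mF')
    have dG' : DependsOn G' (insert v W : Finset ι) := dependsOn_avg ρ _ _
    have mGW : Measurable (G' / avg ρ W f) := mG'.div mW
    calc ∫⁻ x, (F * avg ρ (insert v T) f) x ∂Measure.pi ρ
        = ∫⁻ x, (f * F') x ∂Measure.pi ρ := by rw [lintegral_mul_avg ρ _ hF hf, mul_comm]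
      _ = ∫⁻ x, (f * resample κ F') x ∂Measure.pi ρ := H F' mF' dF'
      _ = ∫⁻ x, (avg ρ T f * resample κ F') x ∂Measure.pi ρ := by
          refine lintegral_mul_of_dependsOn ρ hf (measurable_resample κ mF') ?_
          exact dependsOn_resample hκ (by exact_mod_cast hWT) (by simpa using dF')
      _ = ∫⁻ x, resample κ (avg ρ T f * F') x ∂Measure.pi ρ := by
          rw [resample_mul_of_dependsOn κ mF' (by simpa using hvT) dT]
      _ = ∫⁻ x, resample κ G' x ∂Measure.pi ρ :=
          (lintegral_resample_avg ρ κ hκ (mT.mul mF')).symm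
      _ = ∫⁻ x, (avg ρ W f * resample κ (G' / avg ρ W f)) x ∂Measure.pi ρ := by
          refine lintegral_congr_ae ?_
          filter_upwards [avg_ne_top_ae ρ W hf h1] with x hx
          simp only [resample, Pi.mul_apply]
          have hm : Measurable fun t => (G' / avg ρ W f) (Function.update x v t) :=
            mGW.comp (measurable_update x)
          rw [← lintegral_const_mul _ hm]
          refine lintegral_congr fun t => ?_
          have : avg ρ W f (Function.update x v t) = avg ρ W f x := by
            refine dW fun i hi => ?_
            rw [Function.update_of_ne]
            rintro rfl
            exact hvW hi
          rw [Pi.div_apply, this, ENNReal.mul_div_cancel (avg_ne_zero ρ W hf h0 x) hx]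
      _ = ∫⁻ x, (f * resample κ (G' / avg ρ W f)) x ∂Measure.pi ρ := by
          refine (lintegral_mul_of_dependsOn ρ hf (measurable_resample κ mGW) ?_).symm
          refine dependsOn_resample hκ subset_rfl ?_
          have := DependsOn.div dG' (dW.mono (by exact_mod_cast hcW))
          simpa using this
      _ = ∫⁻ x, (f * (G' / avg ρ W f)) x ∂Measure.pi ρ := by
          refine (H _ mGW ?_).symm
          exact (DependsOn.div dG' (dW.mono (by exact_mod_cast hcW))).mono (by exact_mod_cast hcWT)
      _ = ∫⁻ x, (avg ρ (insert v W) f * (G' / avg ρ W f)) x ∂Measure.pi ρ :=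
          lintegral_mul_of_dependsOn ρ hf mGW
            (DependsOn.div dG' (dW.mono (by exact_mod_cast hcW)))
      _ = ∫⁻ x, (avg ρ (insert v W) (avg ρ T f * F') *
            (avg ρ (insert v W) f / avg ρ W f)) x ∂Measure.pi ρ := by
          congr 1; ext x; simp only [Pi.mul_apply, ← hG', div_eq_mul_inv]; ring
      _ = ∫⁻ x, ((avg ρ T f * F') * (avg ρ (insert v W) f / avg ρ W f)) x ∂Measure.pi ρ :=
          (lintegral_mul_of_dependsOn ρ (mT.mul mF') (mvW.div mW)
            (DependsOn.div dvW (dW.mono (by exact_mod_cast hcW)))).symm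
      _ = ∫⁻ x, (F' * (avg ρ T f * (avg ρ (insert v W) f / avg ρ W f))) x ∂Measure.pi ρ := by
          congr 1; ext x; simp only [Pi.mul_apply]; ring
      _ = _ := by
          refine (lintegral_mul_of_dependsOn ρ hF (mT.mul (mvW.div mW)) ?_).symm
          refine DependsOn.mul (dT.mono (by exact_mod_cast hcT)) (DependsOn.mono ?_
            (DependsOn.div dvW (dW.mono (by exact_mod_cast hcW))))
          exact_mod_cast hcWT
  refine ae_eq_of_forall_setLIntegral_eq_of_sigmaFinite (measurable_avg ρ _ hf)
    (mT.mul (mvW.div mW)) fun s hs _ => ?_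
  have := key (s.indicator 1) (measurable_one.indicator hs)
  rw [← lintegral_indicator hs, ← lintegral_indicator hs]
  convert this using 2 <;>
  · ext x
    by_cases hx : x ∈ s <;> simp [hx]

end Averaging

end MBIdent

/-! ### Factorization of a density from conditional independence, and the pointwise cross-ratio
identity. -/

namespace MBIdent

section Separable

open scoped ENNReal

variable {ι : Type*} [Fintype ι] [DecidableEq ι] {X : ι → Type*} [∀ i, MeasurableSpace (X i)]
  (ρ : ∀ i, Measure (X i)) [∀ i, IsProbabilityMeasure (ρ i)]

/-- Almost everywhere, `f` is a product of a function that does not depend on the coordinate `b`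
and one that does not depend on the coordinate `a`. -/
def Separable (a b : ι) (f : (∀ i, X i) → ℝ≥0∞) : Prop :=
  ∃ A B : (∀ i, X i) → ℝ≥0∞, DependsOn A {b}ᶜ ∧ DependsOn B {a}ᶜ ∧ f =ᵐ[Measure.pi ρ] A * B

/-- Choosing each coordinate from one of two independent samples gives a sample of the same law. An
almost sure identity thus holds simultaneously at all the hybrids of two generic points. -/
theorem measurePreserving_piecewise (S : Finset ι) :
    MeasurePreserving (fun q : (∀ i, X i) × (∀ i, X i) => S.piecewise q.2 q.1)
      ((Measure.pi ρ).prod (Measure.pi ρ)) (Measure.pi ρ) := by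
  have hm : Measurable (fun q : (∀ i, X i) × (∀ i, X i) => S.piecewise q.2 q.1) := by
    refine measurable_pi_iff.mpr fun i => ?_
    by_cases h : i ∈ S
    · simp only [Finset.piecewise, h, if_true]; fun_prop
    · simp only [Finset.piecewise, h, if_false]; fun_prop
  refine ⟨hm, (Measure.pi_eq fun s hs => ?_).symm⟩
  rw [Measure.map_apply hm (MeasurableSet.univ_pi hs)]
  have : (fun q : (∀ i, X i) × (∀ i, X i) => S.piecewise q.2 q.1) ⁻¹' (Set.univ.pi s) =
      (Set.univ.pi fun i => if i ∈ S then Set.univ else s i) ×ˢ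
        (Set.univ.pi fun i => if i ∈ S then s i else Set.univ) := by
    ext q
    simp only [Set.mem_preimage, Set.mem_univ_pi, Set.mem_prod]
    rw [← forall_and]
    refine forall_congr' fun i => ?_
    by_cases h : i ∈ S <;> simp [h]
  rw [this, Measure.prod_prod, Measure.pi_pi, Measure.pi_pi, ← Finset.prod_mul_distrib]
  refine Finset.prod_congr rfl fun i _ => ?_
  by_cases h : i ∈ S <;> simp [h]

/-- A continuous separable density satisfies the cross-ratio identity. -/
theorem Separable.cross [∀ i, TopologicalSpace (X i)] [∀ i, (ρ i).IsOpenPosMeasure] {a b : ι}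
    (hab : a ≠ b) {p : (∀ i, X i) → ℝ} (hp : Continuous p) (hpos : ∀ x, 0 < p x)
    (h : Separable ρ a b fun x => ENNReal.ofReal (p x)) (x y : ∀ i, X i) :
    p x * p (Function.update (Function.update x a (y a)) b (y b)) =
      p (Function.update x a (y a)) * p (Function.update x b (y b)) := by
  obtain ⟨A, B, hA, hB, hAB⟩ := h
  let U : Finset ι → (∀ i, X i) × (∀ i, X i) → (∀ i, X i) := fun S q => S.piecewise q.2 q.1
  have hU1 : ∀ c q, U {c} q = Function.update q.1 c (q.2 c) := fun c q =>
    Finset.piecewise_singleton _ _ _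
  have hU2 : ∀ q, U {a, b} q =
      Function.update (Function.update q.1 a (q.2 a)) b (q.2 b) := by
    intro q; ext i
    by_cases hb : i = b
    · subst hb; simp [U]
    · by_cases ha : i = a
      · subst ha; simp [U, Function.update_of_ne hab]
      · simp [U, ha, hb]
  have hU0 : ∀ q, U ∅ q = q.1 := fun q => by simp [U]
  have hae : ∀ S, ∀ᵐ q ∂(Measure.pi ρ).prod (Measure.pi ρ),
      ENNReal.ofReal (p (U S q)) = A (U S q) * B (U S q) := fun S =>
    (measurePreserving_piecewise ρ S).quasiMeasurePreserving.ae hAB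
  -- At the four hybrids only two values of `A` and two of `B` occur, and both sides are the product
  -- of these four.
  have hae2 : (fun q => p (U ∅ q) * p (U {a, b} q)) =ᵐ[(Measure.pi ρ).prod (Measure.pi ρ)]
      fun q => p (U {a} q) * p (U {b} q) := by
    filter_upwards [hae ∅, hae {a}, hae {b}, hae {a, b}] with q h0 ha hb hab'
    have hA1 : A (U {a, b} q) = A (U {a} q) := hA fun i hi => by
      have : i ≠ b := hi
      simp [U, Finset.piecewise, this]
    have hA2 : A (U {b} q) = A (U ∅ q) := hA fun i hi => by
      have : i ≠ b := hi
      simp only [U, Finset.piecewise_singleton, Finset.piecewise_empty, Function.update_of_ne this]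
    have hB1 : B (U {a, b} q) = B (U {b} q) := hB fun i hi => by
      have : i ≠ a := hi
      simp [U, Finset.piecewise, this]
    have hB2 : B (U {a} q) = B (U ∅ q) := hB fun i hi => by
      have : i ≠ a := hi
      simp only [U, Finset.piecewise_singleton, Finset.piecewise_empty, Function.update_of_ne this]
    rw [← ENNReal.ofReal_eq_ofReal_iff (mul_pos (hpos _) (hpos _)).le
      (mul_pos (hpos _) (hpos _)).le, ENNReal.ofReal_mul (hpos _).le,
      ENNReal.ofReal_mul (hpos _).le, h0, ha, hb, hab', hA1, hA2, hB1, hB2]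
    ring
  have hUc : ∀ S, Continuous (U S) := by
    intro S
    refine continuous_pi fun i => ?_
    by_cases h : i ∈ S
    · simp only [U, Finset.piecewise, h, if_true]; fun_prop
    · simp only [U, Finset.piecewise, h, if_false]; fun_prop
  -- Nonempty open sets have positive measure, so continuous functions equal almost everywhere are
  -- equal.
  have := (Continuous.ae_eq_iff_eq _ ((hp.comp (hUc _)).mul (hp.comp (hUc _)))
    ((hp.comp (hUc _)).mul (hp.comp (hUc _)))).mp hae2
  have := congrFun this (x, y)
  simp only [Pi.mul_apply, Function.comp_apply, hU0, hU1, hU2] at this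
  exact this

/-- Multiplying by functions of single coordinates preserves separability. -/
theorem Separable.mul_prod {a b : ι} (hab : a ≠ b) {f : (∀ i, X i) → ℝ≥0∞}
    (h : Separable ρ a b f) (r : ∀ i, X i → ℝ≥0∞) :
    Separable ρ a b fun x => f x * ∏ i, r i (x i) := by
  obtain ⟨A, B, hA, hB, hAB⟩ := h
  refine ⟨A * fun x => ∏ i ∈ Finset.univ.erase b, r i (x i), B * fun x => r b (x b),
    DependsOn.mul hA ?_, DependsOn.mul hB ?_, ?_⟩
  · intro x y hxy
    refine Finset.prod_congr rfl fun i hi => ?_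
    rw [hxy i (by simpa using hi)]
  · intro x y hxy
    dsimp only
    rw [hxy b (by simpa using hab.symm)]
  · filter_upwards [hAB] with x hx
    rw [hx, ← Finset.prod_erase_mul Finset.univ _ (Finset.mem_univ b)]
    simp only [Pi.mul_apply]
    ring

/-- Conditional independence of two coordinates given all others makes the density separable. -/
theorem separable_of_condIndepFun [∀ i, StandardBorelSpace (X i)] {f : (∀ i, X i) → ℝ≥0∞}
    (hf : Measurable f) (h0 : ∀ x, f x ≠ 0) (P : Measure (∀ i, X i)) [IsProbabilityMeasure P]
    (hP : P = (Measure.pi ρ).withDensity f) {a b : ι} (hab : a ≠ b)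
    (hCI : CondIndepFun (MeasurableSpace.comap
      (Set.domRestrict ({a, b}ᶜ : Set ι) : (∀ i, X i) → _) MeasurableSpace.pi)
      (Set.measurable_restrict _).comap_le (Set.domRestrict ({a} : Set ι) : (∀ i, X i) → _)
      (Set.domRestrict ({b} : Set ι) : (∀ i, X i) → _) P) :
    Separable ρ a b f := by
  classical
  have hne : Nonempty (∀ i, X i) := by
    by_contra hne
    rw [not_nonempty_iff] at hne
    have := measure_univ (μ := P)
    rw [Set.univ_eq_empty_iff.mpr hne] at this
    simp at this
  have hX : ∀ i, Nonempty (X i) := fun i => hne.map fun x => x i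
  have h1 : ∫⁻ x, f x ∂Measure.pi ρ = 1 := by
    rw [← measure_univ (μ := P), hP, withDensity_apply _ MeasurableSet.univ,
      Measure.restrict_univ]
  let k : (∀ i, X i) → (∀ i : ({a, b}ᶜ : Set ι), X i) := Set.domRestrict ({a, b}ᶜ : Set ι)
  let g : (∀ i, X i) → (∀ i : ({a} : Set ι), X i) := Set.domRestrict ({a} : Set ι)
  let l : (∀ i, X i) → (∀ i : ({b} : Set ι), X i) := Set.domRestrict ({b} : Set ι)
  have hk : Measurable k := Set.measurable_restrict _
  have hg : Measurable g := Set.measurable_restrict _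
  have hl : Measurable l := Set.measurable_restrict _
  -- Conditional independence in kernel form: the law of the `b` coordinate given all others is a
  -- kernel that does not read the coordinate `a`.
  have hlaw := (condDistrib_ae_eq_iff_measure_eq_compProd _ hl.aemeasurable _).mp
    ((condIndepFun_iff_condDistrib_prod_ae_eq_prodMkRight hl hg hk).mp hCI)
  let ev : (∀ i : ({b} : Set ι), X i) → X b := fun t => t ⟨b, rfl⟩
  have hev : Measurable ev := measurable_pi_apply _
  let κ : Kernel (∀ i, X i) (X b) := ((condDistrib l k P).comap k hk).map ev
  have hκs : IsMarkovKernel κ := by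
    have : IsMarkovKernel ((condDistrib l k P).comap k hk) := inferInstance
    exact Kernel.IsMarkovKernel.map _ hev
  have hκ : DependsOn κ (({a, b}ᶜ : Finset ι) : Set ι) := by
    intro x y hxy
    have : k x = k y := by
      ext i
      exact hxy i (by have := i.2; simp only [Finset.coe_compl, Finset.coe_insert, Finset.coe_singleton]; exact this)
    simp only [κ]
    rw [Kernel.map_apply _ hev, Kernel.map_apply _ hev, Kernel.comap_apply, Kernel.comap_apply,
      this]
  let rec' : ((∀ i : ({a, b}ᶜ : Set ι), X i) × (∀ i : ({a} : Set ι), X i)) ×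
      (∀ i : ({b} : Set ι), X i) → ∀ i, X i := fun q i =>
    if ha : i = a then q.1.2 ⟨i, Set.mem_singleton_iff.mpr ha⟩ else
    if hb : i = b then q.2 ⟨i, Set.mem_singleton_iff.mpr hb⟩ else
      q.1.1 ⟨i, by simp [ha, hb]⟩
  have hrec : Measurable rec' := by
    refine measurable_pi_iff.mpr fun i => ?_
    by_cases ha : i = a
    · simp only [rec', dif_pos ha]
      fun_prop
    · by_cases hb : i = b
      · simp only [rec', dif_neg ha, dif_pos hb]
        fun_prop
      · simp only [rec', dif_neg ha, dif_neg hb]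
        fun_prop
  have hrec1 : ∀ x, rec' ((k x, g x), l x) = x := by
    intro x; ext i
    by_cases ha : i = a
    · subst ha; simp [rec', g]
    · by_cases hb : i = b
      · subst hb; simp [rec', ha, l]
      · simp [rec', ha, hb, k]
  have hrec2 : ∀ x t, rec' ((k x, g x), t) = Function.update x b (ev t) := by
    intro x t; ext i
    by_cases ha : i = a
    · subst ha; simp [rec', g, Function.update_of_ne hab]
    · by_cases hb : i = b
      · subst hb; simp [rec', ha, ev]
      · simp [rec', ha, hb, k]
  have hH : ∀ F : (∀ i, X i) → ℝ≥0∞, Measurable F →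
      ∫⁻ x, (f * F) x ∂Measure.pi ρ = ∫⁻ x, (f * resample κ F) x ∂Measure.pi ρ := by
    intro F hF
    have hFr : Measurable fun q => F (rec' q) := hF.comp hrec
    rw [← lintegral_withDensity_eq_lintegral_mul _ hf hF,
      ← lintegral_withDensity_eq_lintegral_mul _ hf (measurable_resample κ hF), ← hP]
    have e1 : ∫⁻ x, F x ∂P = ∫⁻ q, F (rec' q) ∂P.map fun x => ((k x, g x), l x) := by
      rw [lintegral_map hFr ((hk.prodMk hg).prodMk hl)]
      simp only [hrec1]
    rw [e1, hlaw, Measure.lintegral_compProd hFr, lintegral_map _ (hk.prodMk hg)]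
    · refine lintegral_congr fun x => ?_
      simp only [hrec2, resample, κ, Kernel.prodMkRight_apply]
      have hm : Measurable fun t => F (Function.update x b t) := hF.comp (measurable_update x)
      rw [Kernel.lintegral_map _ hev _ hm, Kernel.comap_apply]
    · exact Measurable.lintegral_kernel_prod_right' hFr
  -- With `T` everything but `b` and `W` everything but `a` and `b`, this reads: `f` is its marginal
  -- off `b` times the ratio of its marginals off `a` and off both.
  have main := avg_insert_ae_eq ρ hf h0 (by rw [h1]; exact ENNReal.one_ne_top)
    (v := b) (W := ({a, b}ᶜ : Finset ι)) (T := ({b}ᶜ : Finset ι)) (by simp)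
    (by intro i; simp) κ hκ fun F hF _ => hH F hF
  have hins : insert b ({b}ᶜ : Finset ι) = Finset.univ := by
    ext i; simp
  have hu : avg ρ (Finset.univ) f = f := by simp [avg]
  rw [hins, hu] at main
  refine ⟨_, _, ?_, ?_, main⟩
  · refine (dependsOn_avg ρ _ f).mono ?_
    simp
  · refine (DependsOn.div (dependsOn_avg ρ _ f) ((dependsOn_avg ρ _ f).mono
      (by exact_mod_cast Finset.subset_insert _ _))).mono ?_
    intro i
    simp only [Finset.coe_insert, Finset.coe_compl, Set.mem_insert_iff, Set.mem_compl_iff]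
    rintro (rfl | h) rfl
    · exact hab rfl
    · simp at h

end Separable

end MBIdent

/-! ### Factorization of a structural equation model along its DAG. -/

namespace MBIdent

section StructuralEquations

open scoped ENNReal

variable {ι : Type*} [Fintype ι] [DecidableEq ι] {X : ι → Type*} [∀ i, MeasurableSpace (X i)]
  (ρ : ∀ i, Measure (X i)) [∀ i, IsProbabilityMeasure (ρ i)]

/-- The parents of a vertex. -/
noncomputable def parents (G : Digraph ι) (v : ι) : Finset ι :=
  open Classical in Finset.univ.filter fun w => G.Adj w v

theorem mem_parents {G : Digraph ι} {v w : ι} : w ∈ parents G v ↔ G.Adj w v := by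
  simp [parents]

theorem IsDAG.wellFounded {G : Digraph ι} (hG : IsDAG G) : WellFounded G.Adj := by
  have : Std.Irrefl (Relation.TransGen G.Adj) := ⟨hG⟩
  exact (Finite.wellFounded_of_trans_of_irrefl (Relation.TransGen G.Adj)).mono
    fun _ _ h => Relation.TransGen.single h

theorem IsDAG.wellFounded_swap {G : Digraph ι} (hG : IsDAG G) :
    WellFounded (Function.swap G.Adj) := by
  have : Std.Irrefl (Function.swap (Relation.TransGen G.Adj)) := ⟨hG⟩
  have : IsTrans ι (Function.swap (Relation.TransGen G.Adj)) :=
    ⟨fun _ _ _ h1 h2 => h2.trans h1⟩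
  exact (Finite.wellFounded_of_trans_of_irrefl (Function.swap (Relation.TransGen G.Adj))).mono
    fun _ _ h => Relation.TransGen.single h

/-- A set of vertices that contains the parents of its members. -/
def IsAncestral (G : Digraph ι) (T : Finset ι) : Prop := ∀ v ∈ T, ∀ w, G.Adj w v → w ∈ T

variable {N : ι → Type*} [∀ v, MeasurableSpace (N v)] (ν : ∀ v, Measure (N v))
  [∀ v, IsProbabilityMeasure (ν v)]

section

variable {G : Digraph ι} {mech : ∀ v, (∀ w : {w // G.Adj w v}, X w) → N v → X v}
  {vars : (∀ v, N v) → ∀ v, X v}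

/-- Unfolding the structural equations from an ancestral set never leaves it, so only the noises of
its members matter. -/
theorem vars_congr (hG : IsDAG G) (hvars : ∀ e v, vars e v = mech v (fun w => vars e w) (e v))
    {T : Finset ι} (hT : IsAncestral G T) {e e' : ∀ v, N v} (h : ∀ v ∈ T, e v = e' v) (v : ι)
    (hv : v ∈ T) : vars e v = vars e' v := by
  induction v using hG.wellFounded.induction with
  | h v ih =>
    rw [hvars e, hvars e', h v hv]
    congr 1
    funext w
    exact ih w w.2 (hT v hv w w.2)

/-- The conditional law of a variable given its parents. -/
noncomputable def mechKernel (mech : ∀ v, (∀ w : {w // G.Adj w v}, X w) → N v → X v) (v : ι) :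
    Kernel (∀ i, X i) (X v) :=
  (Kernel.id ×ₖ Kernel.const (∀ i, X i) (ν v)).map fun q => mech v (fun w => q.1 w) q.2

theorem measurable_mech_pair (hmech : ∀ v, Measurable fun q : (∀ w : {w // G.Adj w v}, X w) × N v =>
    mech v q.1 q.2) (v : ι) :
    Measurable fun q : (∀ i, X i) × N v => mech v (fun w => q.1 w) q.2 := by
  refine (hmech v).comp (f := fun q : (∀ i, X i) × N v =>
    ((fun w : {w // G.Adj w v} => q.1 w), q.2)) ?_
  fun_prop

theorem mechKernel_apply (hmech : ∀ v, Measurable fun q : (∀ w : {w // G.Adj w v}, X w) × N v =>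
    mech v q.1 q.2) (v : ι) (x : ∀ i, X i) :
    mechKernel ν mech v x = (ν v).map (mech v fun w => x w) := by
  rw [mechKernel, Kernel.map_apply _ (measurable_mech_pair hmech v), Kernel.prod_apply,
    Kernel.id_apply, Kernel.const_apply, Measure.dirac_prod,
    Measure.map_map (measurable_mech_pair hmech v) measurable_prodMk_left]
  rfl

theorem lintegral_mechKernel (hmech : ∀ v, Measurable fun q : (∀ w : {w // G.Adj w v}, X w) × N v =>
    mech v q.1 q.2) (v : ι) (x : ∀ i, X i) {F : X v → ℝ≥0∞} (hF : Measurable F) :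
    ∫⁻ t, F t ∂mechKernel ν mech v x = ∫⁻ e, F (mech v (fun w => x w) e) ∂ν v := by
  rw [mechKernel_apply ν hmech, lintegral_map hF]
  exact (hmech v).comp measurable_prodMk_left

theorem dependsOn_mechKernel
    (hmech : ∀ v, Measurable fun q : (∀ w : {w // G.Adj w v}, X w) × N v => mech v q.1 q.2)
    (v : ι) : DependsOn (mechKernel ν mech v) (parents G v : Set ι) := by
  intro x y hxy
  rw [mechKernel_apply ν hmech, mechKernel_apply ν hmech]
  have : (fun w : {w // G.Adj w v} => x w) = fun w : {w // G.Adj w v} => y w := by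
    funext w
    exact hxy w (by exact_mod_cast mem_parents.mpr w.2)
  rw [this]

/-- The density of the law of a variable given its parents. -/
noncomputable def condDensity (G : Digraph ι) (f : (∀ i, X i) → ℝ≥0∞) (v : ι) :
    (∀ i, X i) → ℝ≥0∞ :=
  avg ρ (insert v (parents G v)) f / avg ρ (parents G v) f

theorem dependsOn_condDensity (f : (∀ i, X i) → ℝ≥0∞) (v : ι) :
    DependsOn (condDensity ρ G f v) (insert v (parents G v) : Finset ι) :=
  DependsOn.div (dependsOn_avg ρ _ f) ((dependsOn_avg ρ _ f).mono
    (by exact_mod_cast Finset.subset_insert _ _))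

/-- The law of a structural equation model factorizes along its directed acyclic graph. -/
theorem ae_eq_prod_condDensity (hG : IsDAG G)
    (hmech : ∀ v, Measurable fun q : (∀ w : {w // G.Adj w v}, X w) × N v => mech v q.1 q.2)
    (hvm : Measurable vars) (hvars : ∀ e v, vars e v = mech v (fun w => vars e w) (e v))
    {f : (∀ i, X i) → ℝ≥0∞} (hf : Measurable f) (h0 : ∀ x, f x ≠ 0)
    (hlaw : (Measure.pi ν).map vars = (Measure.pi ρ).withDensity f) :
    f =ᵐ[Measure.pi ρ] ∏ v, condDensity ρ G f v := by
  have h1 : ∫⁻ x, f x ∂Measure.pi ρ = 1 := by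
    have : IsProbabilityMeasure ((Measure.pi ν).map vars) :=
      Measure.isProbabilityMeasure_map hvm.aemeasurable
    rw [← measure_univ (μ := (Measure.pi ν).map vars), hlaw,
      withDensity_apply _ MeasurableSet.univ, Measure.restrict_univ]
  have hκs : ∀ v, IsMarkovKernel (mechKernel ν mech v) := fun v =>
    Kernel.IsMarkovKernel.map _ (measurable_mech_pair hmech v)
  have step : ∀ T : Finset ι, ∀ v, v ∉ T → IsAncestral G T → parents G v ⊆ T →
      avg ρ (insert v T) f =ᵐ[Measure.pi ρ] avg ρ T f * condDensity ρ G f v := by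
    intro T v hvT hT hpa
    refine avg_insert_ae_eq ρ hf h0 (by rw [h1]; exact ENNReal.one_ne_top) hvT hpa
      (mechKernel ν mech v) (dependsOn_mechKernel ν hmech v) fun F hF hFT => ?_
    have hFv : Measurable fun e => F (vars e) := hF.comp hvm
    rw [← lintegral_withDensity_eq_lintegral_mul _ hf hF,
      ← lintegral_withDensity_eq_lintegral_mul _ hf (measurable_resample _ hF), ← hlaw,
      lintegral_map hF hvm, lintegral_map (measurable_resample _ hF) hvm,
      ← lintegral_avg ν ({v}ᶜ : Finset ι) hFv]
    -- With all other noises fixed, integrating over the noise of `v` alone is resampling `v` from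
    -- its mechanism: the variables in `T` do not react to that noise.
    refine lintegral_congr fun e => ?_
    simp only [avg, compl_compl, lmarginal_singleton, resample]
    have hm : Measurable fun t => F (Function.update (vars e) v t) :=
      hF.comp (measurable_update _)
    rw [lintegral_mechKernel ν hmech v _ hm]
    refine lintegral_congr fun t => ?_
    have hagree : ∀ w ∈ T, vars (Function.update e v t) w = vars e w := fun w hw =>
      vars_congr hG hvars hT (fun u hu => Function.update_of_ne (by rintro rfl; exact hvT hu) _ _)
        w hw
    refine hFT fun w hw => ?_
    by_cases hwv : w = v
    · subst hwv
      rw [Function.update_self, hvars, Function.update_self]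
      congr 1
      funext u
      exact hagree u (hpa (mem_parents.mpr u.2))
    · rw [Function.update_of_ne hwv]
      have hw' : w ∈ insert v T := hw
      exact hagree w ((Finset.mem_insert.mp hw').resolve_left hwv)
  have main : ∀ T : Finset ι, IsAncestral G T →
      avg ρ T f =ᵐ[Measure.pi ρ] ∏ v ∈ T, condDensity ρ G f v := by
    intro T
    induction T using Finset.strongInduction with
    | H T ih =>
      intro hT
      rcases T.eq_empty_or_nonempty with rfl | hne
      · refine Filter.Eventually.of_forall fun x => ?_
        simp [avg, h1]
      · obtain ⟨v, hv, hmin⟩ := hG.wellFounded_swap.has_min (T : Set ι) hne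
        have hanc : IsAncestral G (T.erase v) := by
          intro w hw u hu
          refine Finset.mem_erase.mpr ⟨?_, hT w (Finset.mem_of_mem_erase hw) u hu⟩
          rintro rfl
          exact hmin w (Finset.mem_of_mem_erase hw) hu
        have hpa : parents G v ⊆ T.erase v := by
          intro w hw
          rw [mem_parents] at hw
          refine Finset.mem_erase.mpr ⟨?_, hT v hv w hw⟩
          rintro rfl
          exact hG _ (Relation.TransGen.single hw)
        have hs := step (T.erase v) v (Finset.notMem_erase v T) hanc hpa
        rw [Finset.insert_erase hv] at hs
        filter_upwards [hs, ih _ (Finset.erase_ssubset hv) hanc] with x hx hx'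
        rw [hx, ← Finset.prod_erase_mul T _ hv, Pi.mul_apply, Pi.mul_apply, hx']
  have hu := main Finset.univ fun v _ w _ => Finset.mem_univ w
  have hau : avg ρ Finset.univ f = f := by simp [avg]
  rwa [hau] at hu

/-- In a structural equation model, the density is separable in `a` and `b` unless they are
adjacent or have a common child. -/
theorem separable_of_structural (hG : IsDAG G)
    (hmech : ∀ v, Measurable fun q : (∀ w : {w // G.Adj w v}, X w) × N v => mech v q.1 q.2)
    (hvm : Measurable vars) (hvars : ∀ e v, vars e v = mech v (fun w => vars e w) (e v))
    {f : (∀ i, X i) → ℝ≥0∞} (hf : Measurable f) (h0 : ∀ x, f x ≠ 0)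
    (hlaw : (Measure.pi ν).map vars = (Measure.pi ρ).withDensity f) {a b : ι} (hab : a ≠ b)
    (h1 : ¬ G.Adj a b) (h2 : ¬ G.Adj b a) (h3 : ∀ k, G.Adj b k → ¬ G.Adj a k) :
    Separable ρ a b f := by
  classical
  have main := ae_eq_prod_condDensity ρ ν hG hmech hvm hvars hf h0 hlaw
  -- Split the factors by whether they involve `b`. A factor involving both `a` and `b` would come
  -- from an edge between them or from a common child.
  rw [← Finset.prod_filter_mul_prod_filter_not Finset.univ
    (fun v => b ∉ insert v (parents G v))] at main
  refine ⟨_, _, ?_, ?_, main⟩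
  · intro x y hxy
    simp only [Finset.prod_apply]
    refine Finset.prod_congr rfl fun v hv => ?_
    refine dependsOn_condDensity ρ f v fun i hi => hxy i ?_
    rintro rfl
    exact (Finset.mem_filter.mp hv).2 hi
  · intro x y hxy
    simp only [Finset.prod_apply]
    refine Finset.prod_congr rfl fun v hv => ?_
    refine dependsOn_condDensity ρ f v fun i hi => hxy i ?_
    rintro rfl
    have hb := not_not.mp (Finset.mem_filter.mp hv).2
    have hi' : i ∈ insert v (parents G v) := hi
    rw [Finset.mem_insert, mem_parents] at hi' hb
    rcases hb with rfl | hb <;> rcases hi' with rfl | hi'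
    · exact hab rfl
    · exact h1 hi'
    · exact h2 hb
    · exact h3 v hb hi'

end

end StructuralEquations

end MBIdent

/-! ### Reference probability measures: standard Gaussian for the latents, uniform for the label. -/

namespace MBIdent

theorem pi_withDensity {ι : Type*} [Fintype ι] {X : ι → Type*} [∀ i, MeasurableSpace (X i)]
    (ρ : ∀ i, Measure (X i)) [∀ i, IsProbabilityMeasure (ρ i)] (lam : ∀ i, Measure (X i))
    [∀ i, SigmaFinite (lam i)] {w : ∀ i, X i → ENNReal} (hw : ∀ i, Measurable (w i))
    (h : ∀ i, lam i = (ρ i).withDensity (w i)) :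
    Measure.pi lam = (Measure.pi ρ).withDensity fun x => ∏ i, w i (x i) := by
  refine Measure.pi_eq fun s hs => ?_
  rw [withDensity_apply _ (MeasurableSet.univ_pi hs),
    ← lintegral_indicator (MeasurableSet.univ_pi hs)]
  have hm : ∀ i, Measurable ((s i).indicator (w i)) := fun i => (hw i).indicator (hs i)
  have e1 : (Set.univ.pi s).indicator (fun x => ∏ i, w i (x i)) =
      fun x => ∏ i, (s i).indicator (w i) (x i) := by
    ext x
    by_cases hx : x ∈ Set.univ.pi s
    · rw [Set.indicator_of_mem hx]
      exact Finset.prod_congr rfl fun i _ => (Set.indicator_of_mem (hx i trivial) _).symm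
    · rw [Set.indicator_of_notMem hx]
      rw [Set.mem_univ_pi, not_forall] at hx
      obtain ⟨i, hi⟩ := hx
      exact (Finset.prod_eq_zero (Finset.mem_univ i) (Set.indicator_of_notMem hi _)).symm
  rw [e1, lintegral_prod_eq_prod_lintegral_of_indepFun Finset.univ
    (fun i (x : ∀ i, X i) => (s i).indicator (w i) (x i))
    (iIndepFun_pi fun i => (hm i).aemeasurable) fun i => (hm i).comp (measurable_pi_apply i)]
  refine Finset.prod_congr rfl fun i _ => ?_
  rw [(measurePreserving_eval ρ i).lintegral_comp (hm i), lintegral_indicator (hs i), h i,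
    withDensity_apply _ (hs i)]

section Reference

variable {n C : ℕ}

/-- Lebesgue measure on the range of a latent variable, counting measure on the labels. -/
noncomputable def baseMeasure : ∀ v : Node n, Measure (Val n C v)
  | none => (Measure.count : Measure (Fin C))
  | some _ => (volume : Measure ℝ)

instance instSigmaFiniteBaseMeasure : ∀ v : Node n, SigmaFinite (baseMeasure (C := C) v)
  | none => inferInstanceAs (SigmaFinite (Measure.count : Measure (Fin C)))
  | some _ => inferInstanceAs (SigmaFinite (volume : Measure ℝ))

/-- A probability density on the range of each variable. -/
noncomputable def refDensity : ∀ v : Node n, Val n C v → ENNReal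
  | none => fun _ => (C : ENNReal)⁻¹
  | some _ => gaussianPDF 0 1

theorem measurable_refDensity : ∀ v : Node n, Measurable (refDensity (C := C) v)
  | none => measurable_const
  | some _ => measurable_gaussianPDF 0 1

theorem refDensity_ne_zero : ∀ (v : Node n) (x : Val n C v), refDensity v x ≠ 0
  | none, _ => ENNReal.inv_ne_zero.mpr (ENNReal.natCast_ne_top C)
  | some _, x => (gaussianPDF_pos 0 one_ne_zero x).ne'

theorem refDensity_ne_top [NeZero C] : ∀ (v : Node n) (x : Val n C v), refDensity v x ≠ ⊤
  | none, _ => ENNReal.inv_ne_top.mpr (by simp [NeZero.ne])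
  | some _, x => gaussianPDF_lt_top.ne

/-- A probability measure on the range of each variable. -/
noncomputable def refMeasure (v : Node n) : Measure (Val n C v) :=
  (baseMeasure v).withDensity (refDensity v)

instance instIsProbabilityMeasureRefMeasure [NeZero C] :
    ∀ v : Node n, IsProbabilityMeasure (refMeasure (C := C) v)
  | none => by
    refine ⟨?_⟩
    change ((Measure.count : Measure (Fin C)).withDensity fun _ => (C : ENNReal)⁻¹) Set.univ = 1
    rw [withDensity_const]
    simp only [Measure.smul_apply, Measure.count_univ, smul_eq_mul]
    simp only [ENat.card_eq_coe_fintype_card, Fintype.card_fin, ENat.toENNReal_coe]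
    exact ENNReal.inv_mul_cancel (by simp [NeZero.ne]) (by simp)
  | some _ => by
    change IsProbabilityMeasure ((volume : Measure ℝ).withDensity (gaussianPDF 0 1))
    rw [← gaussianReal_of_var_ne_zero _ one_ne_zero]
    infer_instance

theorem baseMeasure_eq [NeZero C] (v : Node n) :
    baseMeasure (C := C) v = (refMeasure v).withDensity fun x => (refDensity v x)⁻¹ :=
  (withDensity_inv_same (measurable_refDensity v)
    (Filter.Eventually.of_forall fun x => refDensity_ne_zero v x)
    (Filter.Eventually.of_forall fun x => refDensity_ne_top v x)).symm

/-- Averaging requires probability measures, which Lebesgue and counting measure in general are not.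
The conversion factor is a product of functions of single coordinates, harmless for separability by
`Separable.mul_prod`. -/
theorem pi_baseMeasure_eq [NeZero C] :
    Measure.pi (baseMeasure (n := n) (C := C)) =
      (Measure.pi refMeasure).withDensity fun x => ∏ v, (refDensity v (x v))⁻¹ :=
  pi_withDensity refMeasure baseMeasure (w := fun v (x : Val n C v) => (refDensity v x)⁻¹)
    (fun v => (measurable_refDensity v).inv) baseMeasure_eq

/-- The topology on the range of each variable: discrete on the labels. -/
abbrev valTopology : ∀ v : Node n, TopologicalSpace (Val n C v)
  | none => (⊥ : TopologicalSpace (Fin C))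
  | some _ => inferInstanceAs (TopologicalSpace ℝ)

attribute [local instance] valTopology

theorem isOpenPosMeasure_baseMeasure :
    ∀ v : Node n, (baseMeasure (C := C) v).IsOpenPosMeasure
  | none => by
    refine ⟨fun U _ hne => ?_⟩
    change (Measure.count : Measure (Fin C)) U ≠ 0
    rw [Measure.count_ne_zero_iff]
    exact hne
  | some _ => inferInstanceAs ((volume : Measure ℝ).IsOpenPosMeasure)

theorem isOpenPosMeasure_refMeasure [NeZero C] (v : Node n) :
    (refMeasure (C := C) v).IsOpenPosMeasure := by
  have := isOpenPosMeasure_baseMeasure (C := C) v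
  refine Measure.AbsolutelyContinuous.isOpenPosMeasure (μ := baseMeasure v) ?_
  rw [baseMeasure_eq]
  exact withDensity_absolutelyContinuous _ _

theorem measurable_latent : Measurable (latent : Asg n C → Fin n → ℝ) :=
  measurable_pi_iff.mpr fun i => measurable_pi_apply (some i)

theorem measurable_label : Measurable (label : Asg n C → Fin C) :=
  measurable_pi_apply none

/-- The assignment with given latent variables and label. -/
def assemble (q : (Fin n → ℝ) × Fin C) : Asg n C
  | none => q.2
  | some i => q.1 i

@[simp] theorem latent_assemble (q : (Fin n → ℝ) × Fin C) : latent (assemble q) = q.1 := rfl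

@[simp] theorem label_assemble (q : (Fin n → ℝ) × Fin C) : label (assemble q) = q.2 := rfl

@[simp] theorem assemble_latent_label (x : Asg n C) : assemble (latent x, label x) = x := by
  funext v
  cases v <;> rfl

theorem measurable_assemble : Measurable (assemble : (Fin n → ℝ) × Fin C → Asg n C) := by
  refine measurable_pi_iff.mpr fun v => ?_
  cases v with
  | none => exact measurable_snd
  | some i => exact (measurable_pi_apply i).comp measurable_fst

theorem map_assemble :
    (((volume : Measure (Fin n → ℝ)).prod (Measure.count : Measure (Fin C))).map assemble) =
      Measure.pi (baseMeasure (n := n) (C := C)) := by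
  have h := Measure.pi_map_piOptionEquivProd (baseMeasure (n := n) (C := C))
  rw [← h]
  congr 1
  funext q v
  cases v <;> rfl

theorem update_assemble_some (z : Fin n → ℝ) (c : Fin C) (i : Fin n) (s : ℝ) :
    Function.update (assemble (z, c)) (some i) s = assemble (Function.update z i s, c) := by
  funext v
  cases v with
  | none => rfl
  | some j =>
    by_cases h : j = i
    · subst h; simp [assemble]
    · have : (some j : Node n) ≠ some i := by simpa using h
      rw [Function.update_of_ne this]
      simp [assemble, h]

theorem update_assemble_none (z : Fin n → ℝ) (c c' : Fin C) :
    Function.update (assemble (z, c)) none c' = assemble (z, c') := by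
  funext v
  cases v with
  | none => rfl
  | some j => rfl

end Reference

/-! ### Cross-ratio identities for the model densities, and blanket members as neighbors of the
label. -/

namespace Model

variable {n d C : ℕ} {U : Type*} (M : Model n d C U)

theorem continuous_density (u : U) (c : Fin C) : Continuous fun z => M.density u z c :=
  (M.density_diff u c).1.continuous

theorem measurable_density (u : U) :
    Measurable fun q : (Fin n → ℝ) × Fin C => M.density u q.1 q.2 :=
  measurable_from_prod_countable_left fun c => (M.continuous_density u c).measurable

/-- The density of the law with respect to the reference probability measure. -/
noncomputable def refRatio (u : U) (x : Asg n C) : ENNReal :=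
  ENNReal.ofReal (M.density u (latent x) (label x)) * ∏ v, (refDensity v (x v))⁻¹

theorem measurable_refRatio (u : U) : Measurable (M.refRatio u) := by
  refine Measurable.mul ?_ (Finset.measurable_prod _ fun v _ => ?_)
  · exact ((M.measurable_density u).comp
      (measurable_latent.prodMk measurable_label)).ennreal_ofReal
  · exact ((measurable_refDensity v).comp (measurable_pi_apply v)).inv

theorem refRatio_ne_zero [NeZero C] (u : U) (x : Asg n C) : M.refRatio u x ≠ 0 := by
  refine mul_ne_zero ?_ (Finset.prod_ne_zero_iff.mpr fun v _ => ?_)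
  · simpa using M.density_pos u _ _
  · exact ENNReal.inv_ne_zero.mpr (refDensity_ne_top v _)

theorem law_eq_map (u : U) :
    M.law u = (((volume : Measure (Fin n → ℝ)).prod
      (Measure.count : Measure (Fin C))).withDensity
        fun q => ENNReal.ofReal (M.density u q.1 q.2)).map assemble := by
  rw [← M.density_eq u, Measure.map_map measurable_assemble
    (measurable_latent.prodMk measurable_label)]
  have : (assemble ∘ fun x : Asg n C => (latent x, label x)) = id := by
    funext x; simp
  rw [this, Measure.map_id]
  rfl

theorem law_eq [NeZero C] (u : U) :
    M.law u = (Measure.pi refMeasure).withDensity (M.refRatio u) := by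
  have hp : Measurable fun x : Asg n C => ENNReal.ofReal (M.density u (latent x) (label x)) :=
    ((M.measurable_density u).comp (measurable_latent.prodMk measurable_label)).ennreal_ofReal
  have h2 : Measurable fun x : Asg n C => ∏ v, (refDensity v (x v))⁻¹ :=
    Finset.measurable_prod _ fun v _ =>
      ((measurable_refDensity v).comp (measurable_pi_apply v)).inv
  have e1 : M.refRatio u = (fun x : Asg n C => ∏ v, (refDensity v (x v))⁻¹) *
      fun x => ENNReal.ofReal (M.density u (latent x) (label x)) := by
    funext x; simp only [refRatio, Pi.mul_apply, mul_comm]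
  rw [e1, withDensity_mul _ h2 hp, ← pi_baseMeasure_eq, law_eq_map, ← map_assemble]
  ext s hs
  rw [Measure.map_apply measurable_assemble hs, withDensity_apply _ (measurable_assemble hs),
    withDensity_apply _ hs, setLIntegral_map hs hp measurable_assemble]
  rfl

instance instIsProbabilityMeasureLaw (u : U) : IsProbabilityMeasure (M.law u) :=
  Measure.isProbabilityMeasure_map (M.measurable_vars u).aemeasurable

attribute [local instance] valTopology

theorem continuous_density_asg (u : U) :
    Continuous fun x : Asg n C => M.density u (latent x) (label x) := by
  let _ : TopologicalSpace (Fin C) := ⊥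
  have _ : DiscreteTopology (Fin C) := ⟨rfl⟩
  have h : Continuous fun q : (Fin n → ℝ) × Fin C => M.density u q.1 q.2 :=
    continuous_prod_of_discrete_right.mpr fun c => M.continuous_density u c
  have h1 : Continuous (latent : Asg n C → Fin n → ℝ) :=
    continuous_pi fun i => continuous_apply (some i)
  have h2 : Continuous (label : Asg n C → Fin C) := continuous_apply none
  exact h.comp (h1.prodMk h2)

theorem cross_of_separable [NeZero C] {u : U} {a b : Node n} (hab : a ≠ b)
    (h : Separable refMeasure a b (M.refRatio u)) (x y : Asg n C) :
    let p := fun x : Asg n C => M.density u (latent x) (label x)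
    p x * p (Function.update (Function.update x a (y a)) b (y b)) =
      p (Function.update x a (y a)) * p (Function.update x b (y b)) := by
  have := fun v => isOpenPosMeasure_refMeasure (n := n) (C := C) v
  refine Separable.cross refMeasure hab (M.continuous_density_asg u)
    (fun x => M.density_pos u _ _) ?_ x y
  -- Multiplying the reference densities back in recovers the original, continuous density.
  have h' := h.mul_prod refMeasure hab refDensity
  convert h' using 2 with x
  rw [refRatio, mul_assoc, ← Finset.prod_mul_distrib, Finset.prod_eq_one, mul_one]
  exact fun v _ => ENNReal.inv_mul_cancel (refDensity_ne_zero v _) (refDensity_ne_top v _)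

theorem separable_of_not_adj [NeZero C] {a b : Node n} (hab : a ≠ b)
    (h : ¬ M.markovNet.Adj a b) (u : U) : Separable refMeasure a b (M.refRatio u) := by
  have hCI : CondIndepVars (M.law u) {a} {b} {a, b}ᶜ := by
    by_contra hc
    exact h ⟨hab, u, hc⟩
  exact separable_of_condIndepFun refMeasure (M.measurable_refRatio u) (M.refRatio_ne_zero u)
    (M.law u) (M.law_eq u) hab hCI

/-- Being neither parent, child nor spouse of the label is what `separable_of_structural` asks for.
-/
theorem separable_of_notMem_blanket [NeZero C] {i : Fin n} (h : i ∉ M.blanket) (u : U) :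
    Separable refMeasure (some i) none (M.refRatio u) := by
  simp only [blanket, labelBlanket, Finset.mem_filter, Finset.mem_univ, true_and, not_or,
    not_exists, not_and] at h
  exact separable_of_structural refMeasure M.noiseLaw
    (mech := fun v p e => M.mech v p e (M.param u v)) M.isDAG (fun v => M.measurable_mech v _)
    (M.measurable_vars u) (M.vars_eq u) (M.measurable_refRatio u) (M.refRatio_ne_zero u)
    (M.law_eq u) (by simp) h.1 h.2.1 h.2.2

theorem density_cross_latent [NeZero C] {i j : Fin n} (hij : i ≠ j)
    (h : ¬ M.markovNet.Adj (some i) (some j)) (u : U) (c : Fin C) (z : Fin n → ℝ) (s t : ℝ) :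
    M.density u z c * M.density u (Function.update (Function.update z i s) j t) c =
      M.density u (Function.update z i s) c * M.density u (Function.update z j t) c := by
  have hne : (some i : Node n) ≠ some j := by simpa using hij
  have := M.cross_of_separable hne (M.separable_of_not_adj hne h u) (assemble (z, c))
    (assemble (Function.update (Function.update z i s) j t, c))
  have e1 : (assemble (Function.update (Function.update z i s) j t, c) : Asg n C) (some i) = s := by
    simp [assemble, Function.update_of_ne hij]
  have e2 : (assemble (Function.update (Function.update z i s) j t, c) : Asg n C) (some j) = t := by
    simp [assemble]
  simp only [e1, e2] at this
  simpa only [update_assemble_some, latent_assemble, label_assemble] using this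

theorem density_cross_label [NeZero C] {u : U} {i : Fin n}
    (h : Separable refMeasure (some i) none (M.refRatio u)) (c c' : Fin C)
    (z : Fin n → ℝ) (s : ℝ) :
    M.density u z c * M.density u (Function.update z i s) c' =
      M.density u (Function.update z i s) c * M.density u z c' := by
  have hne : (some i : Node n) ≠ none := by simp
  have := M.cross_of_separable hne h (assemble (z, c)) (assemble (Function.update z i s, c'))
  have e1 : (assemble (Function.update z i s, c') : Asg n C) (some i) = s := by
    simp [assemble]
  have e2 : (assemble (Function.update z i s, c') : Asg n C) none = c' := rfl
  simp only [e1, e2] at this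
  simpa only [update_assemble_some, update_assemble_none, latent_assemble, label_assemble]
    using this

/-- Given all other variables, a single edge is an active path, and so is the path through a common
child, a collider that is conditioned on. Faithfulness then excludes the conditional independence.
-/
theorem adj_of_mem_blanket (hM : M.Faithful) {i : Fin n} [Nonempty U] (h : i ∈ M.blanket) :
    M.markovNet.Adj (some i) none := by
  obtain ⟨u⟩ := ‹Nonempty U›
  refine ⟨by simp, u, fun hCI => ?_⟩
  have hsep := hM u {some i} {none} {some i, none}ᶜ (by simp)
    (by simp) (by simp) hCI (some i) rfl none rfl
  simp only [blanket, labelBlanket, Finset.mem_filter, Finset.mem_univ, true_and] at h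
  rw [← or_assoc] at h
  rcases h with h | ⟨k, hk1, hk2⟩
  · have hadj : M.graph.toSimpleGraphInclusive.Adj (some i) none := ⟨by simp, h⟩
    refine hsep hadj.toWalk (by simp) ?_
    intro k hk hk'
    simp at hk'
    omega
  · have hk0 : k ≠ none := by
      rintro rfl
      exact M.isDAG _ (Relation.TransGen.single hk1)
    have hki : k ≠ some i := by
      rintro rfl
      exact M.isDAG _ (Relation.TransGen.single hk2)
    have hadj1 : M.graph.toSimpleGraphInclusive.Adj (some i) k := ⟨hki.symm, Or.inl hk2⟩
    have hadj2 : M.graph.toSimpleGraphInclusive.Adj k none := ⟨hk0, Or.inr hk1⟩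
    refine hsep (.cons hadj1 hadj2.toWalk) ?_ ?_
    · simp [SimpleGraph.Walk.cons_isPath_iff, hki.symm, hk0]
    · intro m hm hm'
      simp at hm'
      have hm1 : m = 1 := by omega
      subst hm1
      -- The collider `k` is its own descendant in the conditioning set.
      refine ⟨fun _ => ⟨k, by simp [hk0, hki], ?_⟩, fun hcol => ?_⟩
      · simpa using Relation.ReflTransGen.refl
      · exact absurd (by simpa [IsCollider] using ⟨hk2, hk1⟩) hcol

end Model

end MBIdent

/-! ### The conditional law of the label, and its neighbors as blanket members. -/

namespace MBIdent

/-- The σ-algebra generated by the latent variables. -/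
abbrev latentSigma (n C : ℕ) : MeasurableSpace (Asg n C) :=
  MeasurableSpace.comap latent MeasurableSpace.pi

/-- The σ-algebra generated by the variables in `S`. -/
abbrev varSigma {n : ℕ} (C : ℕ) (S : Set (Node n)) : MeasurableSpace (Asg n C) :=
  MeasurableSpace.comap (S.domRestrict : Asg n C → _) MeasurableSpace.pi

namespace Model

variable {n d C : ℕ} {U : Type*} (M : Model n d C U)

/-- The conditional probability that the label is in `B`, given the latent variables. -/
noncomputable def labelProb (u : U) (B : Set (Fin C)) (z : Fin n → ℝ) : ℝ :=
  (∑ c, B.indicator (fun c => M.density u z c) c) / ∑ c, M.density u z c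

theorem sum_density_pos [NeZero C] (u : U) (z : Fin n → ℝ) : 0 < ∑ c, M.density u z c :=
  Finset.sum_pos (fun c _ => M.density_pos u z c) ⟨0, Finset.mem_univ _⟩

theorem labelProb_nonneg (u : U) (B : Set (Fin C)) (z : Fin n → ℝ) : 0 ≤ M.labelProb u B z :=
  div_nonneg (Finset.sum_nonneg fun c _ => Set.indicator_nonneg
    (fun c _ => (M.density_pos u z c).le) c) (Finset.sum_nonneg fun c _ => (M.density_pos u z c).le)

theorem labelProb_le_one (u : U) (B : Set (Fin C)) (z : Fin n → ℝ) : M.labelProb u B z ≤ 1 :=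
  div_le_one_of_le₀ (Finset.sum_le_sum fun c _ => Set.indicator_le_self'
    (fun c _ => (M.density_pos u z c).le) c) (Finset.sum_nonneg fun c _ => (M.density_pos u z c).le)

theorem measurable_labelProb (u : U) (B : Set (Fin C)) : Measurable (M.labelProb u B) := by
  refine Measurable.div (Finset.measurable_sum _ fun c _ => ?_)
    (Finset.measurable_sum _ fun c _ => (M.continuous_density u c).measurable)
  by_cases hc : c ∈ B
  · simpa [hc] using (M.continuous_density u c).measurable
  · simp [hc]

theorem lintegral_law_latent (u : U) {F : Asg n C → ENNReal} (hF : Measurable F) :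
    ∫⁻ x, F x ∂M.law u =
      ∫⁻ z, ∑ c, ENNReal.ofReal (M.density u z c) * F (assemble (z, c)) := by
  have hp := (M.measurable_density u).ennreal_ofReal
  have hFa : Measurable fun q : (Fin n → ℝ) × Fin C => F (assemble q) :=
    hF.comp measurable_assemble
  rw [law_eq_map, lintegral_map hF measurable_assemble,
    lintegral_withDensity_eq_lintegral_mul _ hp hFa, lintegral_prod _ (hp.mul hFa).aemeasurable]
  refine lintegral_congr fun z => ?_
  rw [lintegral_count, tsum_fintype]
  rfl

/-- This makes `labelProb` a version of the conditional probability of the label given the latents.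
-/
theorem setIntegral_labelProb [NeZero C] (u : U) (B : Set (Fin C)) {D : Set (Fin n → ℝ)}
    (hD : MeasurableSet D) :
    ∫ x in latent ⁻¹' D, M.labelProb u B (latent x) ∂M.law u =
      ∫ x in latent ⁻¹' D, (label ⁻¹' B).indicator (fun _ => (1 : ℝ)) x ∂M.law u := by
  have hB : MeasurableSet (label ⁻¹' B : Set (Asg n C)) :=
    measurable_label (Set.toFinite B).measurableSet
  have hD' : MeasurableSet (latent ⁻¹' D : Set (Asg n C)) := measurable_latent hD
  have hm : Measurable fun x : Asg n C => M.labelProb u B (latent x) :=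
    (M.measurable_labelProb u B).comp measurable_latent
  rw [integral_eq_lintegral_of_nonneg_ae
      (Filter.Eventually.of_forall fun x => M.labelProb_nonneg u B _) hm.aestronglyMeasurable,
    integral_eq_lintegral_of_nonneg_ae
      (Filter.Eventually.of_forall fun x => Set.indicator_nonneg (fun _ _ => zero_le_one) x)
      ((measurable_const.indicator hB).aestronglyMeasurable)]
  congr 1
  rw [← lintegral_indicator hD', ← lintegral_indicator hD',
    M.lintegral_law_latent u (hm.ennreal_ofReal.indicator hD'),
    M.lintegral_law_latent u ((measurable_const.indicator hB).ennreal_ofReal.indicator hD')]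
  refine lintegral_congr fun z => ?_
  by_cases hz : z ∈ D
  · have hmem : ∀ c, (assemble (z, c) : Asg n C) ∈ latent ⁻¹' D := fun c => hz
    simp only [Set.indicator_of_mem (hmem _), latent_assemble]
    rw [← Finset.sum_mul, ← ENNReal.ofReal_sum_of_nonneg (fun c _ => (M.density_pos u z c).le),
      ← ENNReal.ofReal_mul (M.sum_density_pos u z).le, labelProb,
      mul_div_cancel₀ _ (M.sum_density_pos u z).ne',
      ENNReal.ofReal_sum_of_nonneg
        (fun c _ => Set.indicator_nonneg (fun c _ => (M.density_pos u z c).le) c)]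
    refine Finset.sum_congr rfl fun c _ => ?_
    by_cases hc : c ∈ B <;> simp [hc, Set.indicator]
  · have hmem : ∀ c, (assemble (z, c) : Asg n C) ∉ latent ⁻¹' D := fun c => hz
    simp only [Set.indicator_of_notMem (hmem _)]

/-- If the conditional law of the label does not depend on `Z_i`, then the label and `Z_i` are
conditionally independent given the other variables. -/
theorem condIndepVars_of_cross [NeZero C] (u : U) (i : Fin n)
    (h : ∀ (c c' : Fin C) (z : Fin n → ℝ) (s : ℝ),
      M.density u z c * M.density u (Function.update z i s) c' =
        M.density u (Function.update z i s) c * M.density u z c') :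
    CondIndepVars (M.law u) {some i} {none} {some i, none}ᶜ := by
  classical
  let S : Set (Node n) := {some i, none}ᶜ
  let r : Asg n C → (∀ v : S, Val n C v) := S.domRestrict
  have hr : Measurable r := Set.measurable_restrict S
  have hml_le : latentSigma n C ≤ MeasurableSpace.pi := measurable_latent.comap_le
  -- The coordinate `i` is filled with `0`, an arbitrary value since `labelProb` ignores it; this
  -- makes `labelProb` measurable in the variables of `S`.
  let ext : (∀ v : S, Val n C v) → Fin n → ℝ := fun y j =>
    if hj : j = i then 0 else y ⟨some j, by simp [S, hj]⟩
  have hext : Measurable ext := by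
    refine measurable_pi_iff.mpr fun j => ?_
    by_cases hj : j = i
    · simp only [ext, dif_pos hj]; exact measurable_const
    · simp only [ext, dif_neg hj]
      exact measurable_pi_apply (X := fun v : S => Val n C v) ⟨some j, by simp [S, hj]⟩
  have hext_r : ∀ x, ext (r x) = Function.update (latent x) i 0 := by
    intro x; funext j
    by_cases hj : j = i
    · subst hj; simp [ext]
    · simp [ext, hj, r, latent]
  have hm'l : varSigma C S ≤ latentSigma n C := by
    rintro _ ⟨s, hs, rfl⟩
    let r' : (Fin n → ℝ) → (∀ v : S, Val n C v) := fun z v =>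
      match v with
      | ⟨some j, _⟩ => z j
      | ⟨none, hv⟩ => absurd (by simp) hv
    have hr' : Measurable r' := by
      refine measurable_pi_iff.mpr fun v => ?_
      match v with
      | ⟨some j, _⟩ => exact measurable_pi_apply j
      | ⟨none, hv⟩ => exact absurd (by simp) hv
    refine ⟨r' ⁻¹' s, hr' hs, ?_⟩
    have : r = r' ∘ latent := by
      funext x v
      match v with
      | ⟨some j, _⟩ => rfl
      | ⟨none, hv⟩ => exact absurd (by simp) hv
    change _ = r ⁻¹' s
    rw [this]
    rfl
  have hprob : ∀ (B : Set (Fin C)) (z : Fin n → ℝ),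
      M.labelProb u B z = M.labelProb u B (Function.update z i 0) := by
    intro B z
    unfold labelProb
    rw [div_eq_div_iff (M.sum_density_pos u _).ne' (M.sum_density_pos u _).ne',
      Finset.sum_mul_sum, Finset.sum_mul_sum]
    refine Finset.sum_congr rfl fun c _ => Finset.sum_congr rfl fun c' _ => ?_
    by_cases hc : c ∈ B
    · simpa [hc] using h c c' z 0
    · simp [hc]
  let H : Set (Fin C) → Asg n C → ℝ := fun B x => M.labelProb u B (latent x)
  have hHm : ∀ B, Measurable (H B) := fun B => (M.measurable_labelProb u B).comp measurable_latent
  have hHm' : ∀ B, StronglyMeasurable[varSigma C S] (H B) := by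
    intro B
    suffices Measurable[varSigma C S] (H B) from this.stronglyMeasurable
    have : H B = (fun y => M.labelProb u B (ext y)) ∘ r := by
      funext x
      simp only [H, Function.comp_apply, hext_r]
      exact hprob B _
    rw [this]
    exact ((M.measurable_labelProb u B).comp hext).comp (comap_measurable r)
  have hHml : ∀ B, StronglyMeasurable[latentSigma n C] (H B) := fun B => (hHm' B).mono hm'l
  have hbdd : ∀ B x, ‖H B x‖ ≤ 1 := fun B x => by
    rw [Real.norm_of_nonneg (M.labelProb_nonneg u B _)]
    exact M.labelProb_le_one u B _
  have hHi : ∀ B, Integrable (H B) (M.law u) := fun B =>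
    Integrable.of_bound (hHm B).aestronglyMeasurable 1 (Filter.Eventually.of_forall (hbdd B))
  have hind : ∀ {A : Set (Asg n C)}, MeasurableSet A →
      Integrable (A.indicator fun _ => (1 : ℝ)) (M.law u) := fun hA =>
    (integrable_const 1).indicator hA
  have hBm : ∀ B : Set (Fin C), MeasurableSet (label ⁻¹' B : Set (Asg n C)) := fun B =>
    measurable_label (Set.toFinite B).measurableSet
  have key : ∀ B : Set (Fin C),
      H B =ᵐ[M.law u] (M.law u)[(label ⁻¹' B).indicator (fun _ => (1 : ℝ)) | latentSigma n C] := by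
    intro B
    refine ae_eq_condExp_of_forall_setIntegral_eq hml_le (hind (hBm B))
      (fun s _ _ => (hHi B).integrableOn) ?_ (hHml B).aestronglyMeasurable
    rintro _ ⟨D, hD, rfl⟩ _
    exact M.setIntegral_labelProb u B hD
  -- Tower property: condition first on all latents, where the event `A` is known and the label
  -- event has probability `H B`, then on `S`, where `H B` is known.
  have hHA : ∀ (A : Set (Asg n C)) (B : Set (Fin C)), MeasurableSet[latentSigma n C] A →
      (M.law u)[(A ∩ label ⁻¹' B).indicator (fun _ => (1 : ℝ)) | varSigma C S] =ᵐ[M.law u]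
        H B * (M.law u)[A.indicator (fun _ => (1 : ℝ)) | varSigma C S] := by
    intro A B hA
    have hA' : MeasurableSet A := hml_le _ hA
    have hprod : (A ∩ label ⁻¹' B).indicator (fun _ => (1 : ℝ)) =
        A.indicator (fun _ => (1 : ℝ)) * (label ⁻¹' B).indicator (fun _ => (1 : ℝ)) := by
      funext x
      simp only [Pi.mul_apply, Set.indicator, Set.mem_inter_iff]
      split_ifs <;> simp_all
    have e1 : (M.law u)[(A ∩ label ⁻¹' B).indicator (fun _ => (1 : ℝ)) | latentSigma n C] =ᵐ[M.law u]
        H B * A.indicator (fun _ => (1 : ℝ)) := by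
      have hpull := condExp_mul_of_stronglyMeasurable_left (m := latentSigma n C) (μ := M.law u)
        (f := A.indicator (fun _ => (1 : ℝ))) (g := (label ⁻¹' B).indicator (fun _ => (1 : ℝ)))
        (stronglyMeasurable_const.indicator hA) (by rw [← hprod]; exact hind (hA'.inter (hBm B)))
        (hind (hBm B))
      rw [hprod]
      refine hpull.trans ?_
      filter_upwards [key B] with x hx
      rw [Pi.mul_apply, Pi.mul_apply, ← hx, mul_comm]
    have hHAi : Integrable (H B * A.indicator (fun _ => (1 : ℝ))) (M.law u) :=
      (hind hA').bdd_mul (hHm B).aestronglyMeasurable (Filter.Eventually.of_forall (hbdd B))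
    calc (M.law u)[(A ∩ label ⁻¹' B).indicator (fun _ => (1 : ℝ)) | varSigma C S]
        =ᵐ[M.law u] (M.law u)[(M.law u)[(A ∩ label ⁻¹' B).indicator (fun _ => (1 : ℝ)) | latentSigma n C] | varSigma C S]
          := (condExp_condExp_of_le hm'l hml_le).symm
      _ =ᵐ[M.law u] (M.law u)[H B * A.indicator (fun _ => (1 : ℝ)) | varSigma C S] := condExp_congr_ae e1
      _ =ᵐ[M.law u] _ := condExp_mul_of_stronglyMeasurable_left (hHm' B) hHAi (hind hA')
  unfold CondIndepVars
  rw [condIndepFun_iff_condExp_inter_preimage_eq_mul (Set.measurable_restrict _)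
    (Set.measurable_restrict _)]
  intro s t hs ht
  set A : Set (Asg n C) := (Set.domRestrict ({some i} : Set (Node n)) : Asg n C → _) ⁻¹' s with hAdef
  have hA : MeasurableSet[latentSigma n C] A := by
    let r' : (Fin n → ℝ) → (∀ v : ({some i} : Set (Node n)), Val n C v) := fun z v =>
      match v with
      | ⟨some j, _⟩ => z j
      | ⟨none, hv⟩ => absurd hv (by simp)
    have hr' : Measurable r' := by
      refine measurable_pi_iff.mpr fun v => ?_
      match v with
      | ⟨some j, _⟩ => exact measurable_pi_apply j
      | ⟨none, hv⟩ => exact absurd hv (by simp)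
    refine ⟨r' ⁻¹' s, hr' hs, ?_⟩
    rw [hAdef, ← Set.preimage_comp]
    congr 1
    funext x v
    match v with
    | ⟨some j, _⟩ => rfl
    | ⟨none, hv⟩ => exact absurd hv (by simp)
  let B : Set (Fin C) := {c | ∃ y ∈ t, y ⟨none, rfl⟩ = c}
  have hB : (Set.domRestrict ({none} : Set (Node n)) : Asg n C → _) ⁻¹' t = label ⁻¹' B := by
    ext x
    constructor
    · intro hx
      exact ⟨_, hx, rfl⟩
    · rintro ⟨y, hy, hyx⟩
      have : (Set.domRestrict ({none} : Set (Node n)) : Asg n C → _) x = y := by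
        funext v
        obtain ⟨v, hv⟩ := v
        rw [Set.mem_singleton_iff] at hv
        subst hv
        exact hyx.symm
      rw [Set.mem_preimage, this]
      exact hy
  rw [hB]
  have h1 := hHA A B hA
  -- The whole space for `A` identifies `H B` as the conditional probability of the label event
  -- given `S`.
  have h2 := hHA Set.univ B MeasurableSet.univ
  filter_upwards [h1, h2] with x hx1 hx2
  change (M.law u)[(A ∩ label ⁻¹' B).indicator (fun _ => (1 : ℝ)) | varSigma C S] x =
    (M.law u)[A.indicator (fun _ => (1 : ℝ)) | varSigma C S] x *
      (M.law u)[(label ⁻¹' B).indicator (fun _ => (1 : ℝ)) | varSigma C S] x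
  rw [Set.univ_inter, Set.indicator_univ, Pi.mul_apply, condExp_const (hm'l.trans hml_le),
    mul_one] at hx2
  rw [hx1, hx2, Pi.mul_apply, mul_comm]

/-- Off the blanket the density factorizes along the DAG, so the conditional law of the label does
not see `Z_i`. -/
theorem mem_blanket_of_adj [NeZero C] {i : Fin n} (h : M.markovNet.Adj (some i) none) :
    i ∈ M.blanket := by
  by_contra hi
  obtain ⟨_, u, hu⟩ := h
  exact hu (M.condIndepVars_of_cross u i
    (M.density_cross_label (M.separable_of_notMem_blanket hi u)))

theorem mem_blanket_iff [NeZero C] [Nonempty U] (hM : M.Faithful) {i : Fin n} :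
    i ∈ M.blanket ↔ M.markovNet.Adj (some i) none :=
  ⟨M.adj_of_mem_blanket hM, M.mem_blanket_of_adj⟩

end Model

end MBIdent

/-! ### The transition map between two equivalent models and its change of variables. -/

namespace MBIdent

namespace Model

variable {n d C : ℕ} {U : Type*} (M L : Model n d C U)

/-- The latent variables of `L` as functions of those of `M`. -/
noncomputable def transition : (Fin n → ℝ) → (Fin n → ℝ) := Function.invFun L.mix ∘ M.mix

variable {M L}

theorem mix_transition (h : Set.range M.mix = Set.range L.mix) (z : Fin n → ℝ) :
    L.mix (transition M L z) = M.mix z :=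
  Function.invFun_eq (by
    have : M.mix z ∈ Set.range L.mix := h ▸ Set.mem_range_self z
    exact this)

theorem transition_transition (h : Set.range M.mix = Set.range L.mix) (z : Fin n → ℝ) :
    transition L M (transition M L z) = z := by
  apply M.mix_smooth.injective
  rw [mix_transition h.symm, mix_transition h]

theorem contDiff_transition (h : Set.range M.mix = Set.range L.mix) :
    ContDiff ℝ ∞ (transition M L) := by
  rw [← contDiffOn_univ]
  exact L.mix_smooth.contDiffOn_inv.comp M.mix_smooth.contDiff.contDiffOn
    fun z _ => h ▸ Set.mem_range_self z

variable (M L)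

/-- The joint law of the latent variables and the label. -/
noncomputable def jointLaw (u : U) : Measure ((Fin n → ℝ) × Fin C) :=
  ((volume : Measure (Fin n → ℝ)).prod (Measure.count : Measure (Fin C))).withDensity
    fun q => ENNReal.ofReal (M.density u q.1 q.2)

theorem jointLaw_prod_singleton (u : U) {E : Set (Fin n → ℝ)} (hE : MeasurableSet E) (c : Fin C) :
    M.jointLaw u (E ×ˢ {c}) = ∫⁻ z in E, ENNReal.ofReal (M.density u z c) := by
  rw [jointLaw, withDensity_apply _ (hE.prod (measurableSet_singleton c)),
    ← Measure.prod_restrict, lintegral_prod_symm _ (M.measurable_density u).ennreal_ofReal.aemeasurable,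
    Measure.restrict_singleton, lintegral_smul_measure, lintegral_dirac]
  simp

theorem obsLaw_eq (u : U) : M.obsLaw u = (M.jointLaw u).map (Prod.map M.mix id) := by
  have hm : Measurable M.mix := M.mix_smooth.contDiff.continuous.measurable
  rw [obsLaw, jointLaw, ← M.density_eq u, Measure.map_map (by fun_prop)
    (measurable_latent.prodMk measurable_label)]
  rfl

variable {M L}

/-- An injective measurable map between standard Borel spaces is a measurable embedding, so the law
of the learned latents and the label can be read off from that of the features and the label. -/
theorem map_jointLaw (h : ObsEquiv M L) (u : U) :
    (M.jointLaw u).map (Prod.map (transition M L) id) = L.jointLaw u := by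
  have hm : Measurable L.mix := L.mix_smooth.contDiff.continuous.measurable
  have ht : Measurable (transition M L) := (contDiff_transition h.1).continuous.measurable
  have hemb : MeasurableEmbedding (Prod.map L.mix (id : Fin C → Fin C)) :=
    (hm.prodMap measurable_id).measurableEmbedding
      (L.mix_smooth.injective.prodMap Function.injective_id)
  apply hemb.map_injective
  rw [← obsLaw_eq, ← h.2 u, obsLaw_eq, Measure.map_map hemb.measurable (ht.prodMap measurable_id)]
  congr 1
  funext q
  exact Prod.ext (mix_transition h.1 q.1) rfl

/-- The change of variables formula for the joint densities. -/
theorem density_eq_det_mul (h : ObsEquiv M L) (u : U) (c : Fin C) (z : Fin n → ℝ) :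
    M.density u z c =
      |(fderiv ℝ (transition M L) z).det| * L.density u (transition M L z) c := by
  have hs := contDiff_transition h.1
  have hs' := contDiff_transition h.1.symm
  have hd : Differentiable ℝ (transition M L) := hs.differentiable (by simp)
  have hcdet : Continuous fun z => |(fderiv ℝ (transition M L) z).det| :=
    (ContinuousLinearMap.continuous_det.comp (hs.continuous_fderiv (by simp))).abs
  have hcL : Continuous fun z => L.density u (transition M L z) c :=
    (L.continuous_density u c).comp hs.continuous
  have hset : ∀ D : Set (Fin n → ℝ), MeasurableSet D →
      ∫⁻ z in D, ENNReal.ofReal (M.density u z c) =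
        ∫⁻ z in D, ENNReal.ofReal (|(fderiv ℝ (transition M L) z).det| *
          L.density u (transition M L z) c) := by
    intro D hD
    have hE : MeasurableSet (transition L M ⁻¹' D) := hs'.continuous.measurable hD
    have himg : transition M L '' D = transition L M ⁻¹' D := by
      ext z
      constructor
      · rintro ⟨y, hy, rfl⟩
        simpa [transition_transition h.1] using hy
      · intro hz
        exact ⟨_, hz, transition_transition h.1.symm z⟩
    have h1 := M.jointLaw_prod_singleton u hD c
    have h2 := L.jointLaw_prod_singleton u hE c
    rw [← map_jointLaw h u, Measure.map_apply (hs.continuous.measurable.prodMap measurable_id)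
      (hE.prod (measurableSet_singleton c))] at h2
    have hpre' : Prod.map (transition M L) id ⁻¹' ((transition L M ⁻¹' D) ×ˢ {c}) =
        D ×ˢ ({c} : Set (Fin C)) := by
      ext q; simp [transition_transition h.1]
    rw [hpre', h1] at h2
    rw [h2, ← himg, lintegral_image_eq_lintegral_abs_det_fderiv_mul volume hD
      (fun z _ => (hd z).hasFDerivAt.hasFDerivWithinAt)
      (Function.LeftInverse.injective (transition_transition h.1)).injOn]
    simp only [ENNReal.ofReal_mul (abs_nonneg _)]
  -- Equal integrals give equality almost everywhere; continuity of both sides makes it hold at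
  -- every point.
  have hae := ae_eq_of_forall_setLIntegral_eq_of_sigmaFinite
    (M.continuous_density u c).measurable.ennreal_ofReal
    (hcdet.mul hcL).measurable.ennreal_ofReal fun s hs _ => hset s hs
  have hae' : (fun z => M.density u z c) =ᵐ[volume] fun z =>
      |(fderiv ℝ (transition M L) z).det| * L.density u (transition M L z) c := by
    filter_upwards [hae] with z hz
    simp only [Pi.mul_apply] at hz
    rwa [ENNReal.ofReal_eq_ofReal_iff (M.density_pos u z c).le
      (mul_nonneg (abs_nonneg _) (L.density_pos u _ c).le)] at hz
  exact congrFun ((Continuous.ae_eq_iff_eq volume (M.continuous_density u c)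
    (hcdet.mul hcL)).mp hae') z

end Model

end MBIdent

/-! ### Partial derivatives and the second-order chain rule. -/

namespace MBIdent

section Calculus

variable {n : ℕ}

/-- The third derivative serves to make the second one continuous. -/
theorem ThriceDifferentiable.contDiff_two {f : (Fin n → ℝ) → ℝ} (h : ThriceDifferentiable f) :
    ContDiff ℝ 2 f := by
  have h1 : ContDiff ℝ 1 (fderiv ℝ f) :=
    contDiff_one_iff_fderiv.mpr ⟨h.2.1, h.2.2.continuous⟩
  exact (contDiff_succ_iff_fderiv (n := 1)).mpr ⟨h.1, by simp, h1⟩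

theorem partialDeriv_sub {f g : (Fin n → ℝ) → ℝ} (hf : Differentiable ℝ f)
    (hg : Differentiable ℝ g) (i : Fin n) :
    partialDeriv i (fun z => f z - g z) = fun z => partialDeriv i f z - partialDeriv i g z := by
  funext z
  simp only [partialDeriv]
  rw [fderiv_fun_sub (hf z) (hg z)]
  rfl

theorem ContDiff.partialDeriv {f : (Fin n → ℝ) → ℝ} {m k : WithTop ℕ∞} (hf : ContDiff ℝ m f)
    (hk : k + 1 ≤ m) (i : Fin n) : ContDiff ℝ k (partialDeriv i f) :=
  (hf.fderiv_right hk).clm_apply contDiff_const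

theorem partialDeriv_eq_deriv {f : (Fin n → ℝ) → ℝ} (hf : Differentiable ℝ f) (i : Fin n)
    (z : Fin n → ℝ) :
    partialDeriv i f z = deriv (fun s => f (Function.update z i s)) (z i) := by
  have h1 : HasDerivAt (fun s => f (Function.update z i s)) (fderiv ℝ f z (Pi.single i 1)) (z i) := by
    have h2 : HasFDerivAt f (fderiv ℝ f z) (Function.update z i (z i)) := by
      rw [Function.update_eq_self]
      exact (hf z).hasFDerivAt
    exact h2.comp_hasDerivAt (z i) (hasDerivAt_update z i (z i))
  exact h1.deriv.symm

theorem partialDeriv_eq_zero {f : (Fin n → ℝ) → ℝ} (hf : Differentiable ℝ f) {i : Fin n}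
    (h : ∀ z s, f (Function.update z i s) = f z) (z : Fin n → ℝ) : partialDeriv i f z = 0 := by
  rw [partialDeriv_eq_deriv hf]
  simp only [h, deriv_const']

/-- A function whose mixed second differences vanish has a vanishing mixed derivative. -/
theorem partialDeriv_partialDeriv_eq_zero {f : (Fin n → ℝ) → ℝ} (hf : ContDiff ℝ 2 f)
    {i j : Fin n} (hij : i ≠ j)
    (h : ∀ z s t, f z + f (Function.update (Function.update z i s) j t) =
      f (Function.update z i s) + f (Function.update z j t)) (z : Fin n → ℝ) :
    partialDeriv j (partialDeriv i f) z = 0 := by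
  have hd : Differentiable ℝ f := hf.differentiable (by simp)
  refine partialDeriv_eq_zero ((ContDiff.partialDeriv hf (k := 1) (by norm_num) i).differentiable
    (by simp)) (fun z t => ?_) z
  rw [partialDeriv_eq_deriv hd, partialDeriv_eq_deriv hd]
  rw [Function.update_of_ne hij]
  have : (fun s => f (Function.update (Function.update z j t) i s)) =
      fun s => f (Function.update z i s) + (f (Function.update z j t) - f z) := by
    funext s
    rw [Function.update_comm hij.symm]
    linarith [h z s t]
  rw [this, deriv_add_const]

theorem partialDeriv_comm {f : (Fin n → ℝ) → ℝ} (hf : ContDiff ℝ 2 f) (i j : Fin n)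
    (z : Fin n → ℝ) :
    partialDeriv j (partialDeriv i f) z = partialDeriv i (partialDeriv j f) z := by
  have hd : Differentiable ℝ (fderiv ℝ f) :=
    (hf.fderiv_right (m := 1) (by norm_num)).differentiable (by simp)
  have e : ∀ a b : Fin n, partialDeriv b (partialDeriv a f) z =
      fderiv ℝ (fderiv ℝ f) z (Pi.single b 1) (Pi.single a 1) := by
    intro a b
    have : partialDeriv a f = fun z => fderiv ℝ f z (Pi.single a 1) := rfl
    rw [this, partialDeriv, fderiv_clm_apply (hd z) (differentiableAt_const _)]
    simp
  rw [e, e]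
  exact (hf.contDiffAt.isSymmSndFDerivAt (by simp)).eq _ _

theorem fderiv_eq_sum_partialDeriv (f : (Fin n → ℝ) → ℝ) (z v : Fin n → ℝ) :
    fderiv ℝ f z v = ∑ i, partialDeriv i f z * v i := by
  conv_lhs => rw [pi_eq_sum_univ' v]
  rw [map_sum]
  refine Finset.sum_congr rfl fun i _ => ?_
  rw [map_smul, smul_eq_mul, mul_comm, partialDeriv]

/-- The entries of the Jacobian matrix: the derivative of the `i`-th component in the `a`-th
coordinate. -/
noncomputable def jac (k : (Fin n → ℝ) → (Fin n → ℝ)) (x : Fin n → ℝ) (i a : Fin n) : ℝ :=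
  partialDeriv a (fun y => k y i) x

theorem partialDeriv_comp {Q : (Fin n → ℝ) → ℝ} {k : (Fin n → ℝ) → (Fin n → ℝ)}
    (hQ : Differentiable ℝ Q) (hk : Differentiable ℝ k) (a : Fin n) (x : Fin n → ℝ) :
    partialDeriv a (fun y => Q (k y)) x = ∑ i, partialDeriv i Q (k x) * jac k x i a := by
  have h1 : fderiv ℝ (fun y => Q (k y)) x = (fderiv ℝ Q (k x)).comp (fderiv ℝ k x) :=
    fderiv_comp x (hQ _) (hk x)
  rw [partialDeriv, h1, ContinuousLinearMap.comp_apply, fderiv_eq_sum_partialDeriv]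
  refine Finset.sum_congr rfl fun i _ => ?_
  have h2 : HasFDerivAt (fun y => k y i) _ x := hasFDerivAt_pi'.mp (hk x).hasFDerivAt i
  rw [jac, partialDeriv, partialDeriv, h2.fderiv]
  rfl

theorem partialDeriv_partialDeriv_comp {Q : (Fin n → ℝ) → ℝ} {k : (Fin n → ℝ) → (Fin n → ℝ)}
    (hQ : ContDiff ℝ 2 Q) (hk : ContDiff ℝ 2 k) (a b : Fin n) (x : Fin n → ℝ) :
    partialDeriv b (partialDeriv a (fun y => Q (k y))) x =
      ∑ i, ∑ j, partialDeriv j (partialDeriv i Q) (k x) * (jac k x j b * jac k x i a) +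
      ∑ i, partialDeriv i Q (k x) * partialDeriv b (partialDeriv a fun y => k y i) x := by
  have hQd : Differentiable ℝ Q := hQ.differentiable (by simp)
  have hkd : Differentiable ℝ k := hk.differentiable (by simp)
  have hQ1 : ∀ i, Differentiable ℝ (partialDeriv i Q) := fun i =>
    (ContDiff.partialDeriv hQ (k := 1) (by norm_num) i).differentiable (by simp)
  have hki : ∀ i, ContDiff ℝ 2 fun y => k y i := fun i => contDiff_pi.mp hk i
  have hk1 : ∀ i, Differentiable ℝ (partialDeriv a fun y => k y i) := fun i =>
    (ContDiff.partialDeriv (hki i) (k := 1) (by norm_num) a).differentiable (by simp)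
  have e1 : partialDeriv a (fun y => Q (k y)) = fun x =>
      ∑ i, partialDeriv i Q (k x) * partialDeriv a (fun y => k y i) x := by
    funext x
    exact partialDeriv_comp hQd hkd a x
  have hcomp : ∀ i, Differentiable ℝ fun x => partialDeriv i Q (k x) := fun i =>
    (hQ1 i).comp hkd
  have hprod : ∀ i ∈ Finset.univ, DifferentiableAt ℝ
      (fun x => partialDeriv i Q (k x) * partialDeriv a (fun y => k y i) x) x := fun i _ =>
    (hcomp i x).mul (hk1 i x)
  rw [e1, partialDeriv, fderiv_fun_sum hprod,
    _root_.sum_apply, ← Finset.sum_add_distrib]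
  refine Finset.sum_congr rfl fun i _ => ?_
  rw [fderiv_fun_mul (hcomp i x) (hk1 i x)]
  have e2 : fderiv ℝ (fun x => partialDeriv i Q (k x)) x (Pi.single b 1) =
      ∑ j, partialDeriv j (partialDeriv i Q) (k x) * jac k x j b :=
    partialDeriv_comp (hQ1 i) hkd b x
  simp only [_root_.add_apply, _root_.smul_apply, smul_eq_mul, e2]
  rw [add_comm, Finset.mul_sum]
  congr 1
  refine Finset.sum_congr rfl fun j _ => ?_
  rw [jac, jac]
  ring

end Calculus

/-! ### Extracting coefficients from linearly independent vectors. -/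

section LinearAlgebra

/-- As many independent vectors as the dimension span the space, so a linear form vanishing on them
is zero. -/
theorem eq_zero_of_linearIndependent {ι κ : Type*} [Fintype ι] [Fintype κ] {v : ι → κ → ℝ}
    (hv : LinearIndependent ℝ v) (hcard : Fintype.card ι = Fintype.card κ) {c : κ → ℝ}
    (h : ∀ k, ∑ x, v k x * c x = 0) : c = 0 := by
  classical
  have hspan := hv.span_eq_top_of_card_eq_finrank' (by simpa using hcard)
  let φ : (κ → ℝ) →ₗ[ℝ] ℝ := ∑ x, c x • LinearMap.proj x
  have hφ : ∀ y, φ y = ∑ x, y x * c x := by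
    intro y
    simp [φ, LinearMap.sum_apply, mul_comm]
  have hker : ⊤ ≤ LinearMap.ker φ := by
    rw [← hspan, Submodule.span_le]
    rintro _ ⟨k, rfl⟩
    simp [hφ, h]
  funext x
  have := hker (Submodule.mem_top : (Pi.single x 1 : κ → ℝ) ∈ ⊤)
  rw [LinearMap.mem_ker, hφ] at this
  simpa [Pi.single_apply] using this

/-- Reorganizes the Hessian sum of the chain rule along the index type of `wVec`: pure second
derivatives, and one mixed derivative per edge. -/
theorem sum_sum_eq_diag_add {n : ℕ} (F : Fin n → Fin n → ℝ) (r : Fin n → Fin n → Prop)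
    (h : ∀ i j, i < j → ¬ r i j → F i j + F j i = 0)
    [Fintype {e : Fin n × Fin n // e.1 < e.2 ∧ r e.1 e.2}] :
    ∑ i, ∑ j, F i j = ∑ i, F i i + ∑ e : {e : Fin n × Fin n // e.1 < e.2 ∧ r e.1 e.2},
      (F e.1.1 e.1.2 + F e.1.2 e.1.1) := by
  classical
  have e1 : ∀ i j, F i j = (if i = j then F i j else 0) + (if i < j then F i j else 0) +
      (if j < i then F i j else 0) := by
    intro i j
    rcases lt_trichotomy i j with h | h | h
    · simp [h, h.ne, h.not_gt]
    · simp [h]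
    · simp [h, h.ne', h.not_gt]
  have e2 : ∑ i, ∑ j, F i j = ∑ i, F i i + ∑ i, ∑ j, (if i < j then F i j + F j i else 0) := by
    conv_lhs => enter [2, i, 2, j]; rw [e1 i j]
    simp only [Finset.sum_add_distrib, Finset.sum_ite_eq, Finset.mem_univ, if_true]
    rw [add_assoc]
    congr 1
    rw [Finset.sum_comm (f := fun i j => if j < i then F i j else 0), ← Finset.sum_add_distrib]
    refine Finset.sum_congr rfl fun i _ => ?_
    rw [← Finset.sum_add_distrib]
    refine Finset.sum_congr rfl fun j _ => ?_
    split_ifs <;> simp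
  rw [e2]
  congr 1
  rw [← Fintype.sum_prod_type' (f := fun i j => if i < j then F i j + F j i else 0)]
  rw [← Finset.sum_subtype (Finset.univ.filter fun e : Fin n × Fin n => e.1 < e.2 ∧ r e.1 e.2)
    (by simp) (fun e => F e.1 e.2 + F e.2 e.1), Finset.sum_filter]
  refine Finset.sum_congr rfl fun e _ => ?_
  by_cases h1 : e.1 < e.2
  · by_cases h2 : r e.1 e.2
    · simp [h1, h2]
    · simp [h1, h2, h e.1 e.2 h1 h2]
  · simp [h1]

end LinearAlgebra

end MBIdent

/-! ### Constraints on the Jacobian from the two sufficient-change conditions. -/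

namespace MBIdent

namespace Model

variable {n d C : ℕ} {U : Type*} {M L : Model n d C U}

theorem contDiff_logDensity (M : Model n d C U) (u : U) (c : Fin C) :
    ContDiff ℝ 2 (M.logDensity u c) :=
  (M.density_diff u c).contDiff_two.log fun z => (M.density_pos u z c).ne'

/-- The log-determinant depends neither on domain nor on label, so it cancels. -/
theorem logDensity_sub_eq (h : ObsEquiv M L) (u u' : U) (c c' : Fin C) (x : Fin n → ℝ) :
    L.logDensity u c x - L.logDensity u' c' x =
      M.logDensity u c (transition L M x) - M.logDensity u' c' (transition L M x) := by
  have e : ∀ u c, M.logDensity u c (transition L M x) =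
      Real.log |(fderiv ℝ (transition M L) (transition L M x)).det| + L.logDensity u c x := by
    intro u c
    have h1 := density_eq_det_mul h u c (transition L M x)
    rw [transition_transition h.1.symm] at h1
    have h2 : |(fderiv ℝ (transition M L) (transition L M x)).det| ≠ 0 := by
      intro h0
      rw [h0, zero_mul] at h1
      exact (M.density_pos u _ c).ne' h1
    simp only [logDensity]
    rw [h1, Real.log_mul h2 (L.density_pos u x c).ne']
  rw [e, e]
  ring

theorem partialDeriv_partialDeriv_logDensity [NeZero C] (M : Model n d C U) {i j : Fin n}
    (hij : i ≠ j) (h : ¬ M.markovNet.Adj (some i) (some j)) (u : U) (c : Fin C)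
    (z : Fin n → ℝ) : partialDeriv j (partialDeriv i (M.logDensity u c)) z = 0 := by
  refine partialDeriv_partialDeriv_eq_zero (M.contDiff_logDensity u c) hij (fun z s t => ?_) z
  have h1 := M.density_cross_latent hij h u c z s t
  simp only [logDensity]
  rw [← Real.log_mul (M.density_pos _ _ _).ne' (M.density_pos _ _ _).ne',
    ← Real.log_mul (M.density_pos _ _ _).ne' (M.density_pos _ _ _).ne', h1]

theorem partialDeriv_logDensity_sub [NeZero C] (M : Model n d C U) {i : Fin n}
    (h : i ∉ M.blanket) (u : U) (c c' : Fin C) (z : Fin n → ℝ) :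
    partialDeriv i (fun z => M.logDensity u c z - M.logDensity u c' z) z = 0 := by
  refine partialDeriv_eq_zero (((M.contDiff_logDensity u c).differentiable (by simp)).sub
    ((M.contDiff_logDensity u c').differentiable (by simp))) (fun z s => ?_) z
  have h1 := M.density_cross_label (M.separable_of_notMem_blanket h u) c c' z s
  have h2 : Real.log (M.density u z c) + Real.log (M.density u (Function.update z i s) c') =
      Real.log (M.density u (Function.update z i s) c) + Real.log (M.density u z c') := by
    rw [← Real.log_mul (M.density_pos _ _ _).ne' (M.density_pos _ _ _).ne',
      ← Real.log_mul (M.density_pos _ _ _).ne' (M.density_pos _ _ _).ne', h1]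
  simp only [Pi.sub_apply, logDensity]
  linarith

theorem contDiff_two_transition (h : ObsEquiv M L) : ContDiff ℝ 2 (transition L M) :=
  contDiff_infty.mp (contDiff_transition h.1.symm) 2

/-- The coefficients of the expansion of a mixed second derivative of a composition. -/
noncomputable def mixedCoeff (M : Model n d C U) (k : (Fin n → ℝ) → (Fin n → ℝ)) (x : Fin n → ℝ)
    (a b : Fin n) : Fin n ⊕ Fin n ⊕ M.LatentEdge → ℝ
  | .inl i => partialDeriv b (partialDeriv a fun y => k y i) x
  | .inr (.inl i) => jac k x i b * jac k x i a
  | .inr (.inr e) => jac k x e.1.2 b * jac k x e.1.1 a + jac k x e.1.1 b * jac k x e.1.2 a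

/-- The mixed derivative of each domain difference vanishes at the non-edge `a`, `b` of `L`.
Expanded by the chain rule, it pairs `mixedCoeff` with a difference of `wVec`s, and these
differences form a basis. -/
theorem mixedCoeff_eq_zero [NeZero C] (hobs : ObsEquiv M L) (hZ : M.SufficientChangesZ)
    {a b : Fin n} (hab : a ≠ b) (hadj : ¬ L.markovNet.Adj (some a) (some b)) (x : Fin n → ℝ) :
    mixedCoeff M (transition L M) x a b = 0 := by
  classical
  obtain ⟨c, u, hli⟩ := hZ (transition L M x)
  have hcard : Fintype.card (Fin (2 * n + Nat.card M.LatentEdge)) =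
      Fintype.card (Fin n ⊕ Fin n ⊕ M.LatentEdge) := by
    rw [Fintype.card_fin, Fintype.card_sum, Fintype.card_sum, Fintype.card_fin,
      Nat.card_eq_fintype_card]
    ring
  refine eq_zero_of_linearIndependent hli hcard fun m => ?_
  set k := transition L M with hk
  have hkc : ContDiff ℝ 2 k := contDiff_two_transition hobs
  let Q : (Fin n → ℝ) → ℝ := fun z => M.logDensity (u m.succ) c z - M.logDensity (u 0) c z
  have hℓ : ∀ u, ContDiff ℝ 2 (M.logDensity u c) := fun u => M.contDiff_logDensity u c
  have hℓd : ∀ u, Differentiable ℝ (M.logDensity u c) := fun u =>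
    (hℓ u).differentiable (by simp)
  have hℓ1 : ∀ u i, Differentiable ℝ (partialDeriv i (M.logDensity u c)) := fun u i =>
    (ContDiff.partialDeriv (hℓ u) (k := 1) (by norm_num) i).differentiable (by simp)
  have hQ : ContDiff ℝ 2 Q := (hℓ _).sub (hℓ _)
  have hQ1 : ∀ i z, partialDeriv i Q z = partialDeriv i (M.logDensity (u m.succ) c) z -
      partialDeriv i (M.logDensity (u 0) c) z := fun i z =>
    congrFun (partialDeriv_sub (hℓd _) (hℓd _) i) z
  have hQ2 : ∀ i j z, partialDeriv j (partialDeriv i Q) z =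
      partialDeriv j (partialDeriv i (M.logDensity (u m.succ) c)) z -
      partialDeriv j (partialDeriv i (M.logDensity (u 0) c)) z := by
    intro i j z
    rw [← congrFun (partialDeriv_sub (hℓ1 _ i) (hℓ1 _ i) j) z]
    congr 1
    funext z
    exact hQ1 i z
  have hzero : partialDeriv b (partialDeriv a fun y => Q (k y)) x = 0 := by
    have e : (fun y => Q (k y)) = fun y => L.logDensity (u m.succ) c y - L.logDensity (u 0) c y := by
      funext y
      exact (logDensity_sub_eq hobs _ _ _ _ y).symm
    have hL : ∀ u, ContDiff ℝ 2 (L.logDensity u c) := fun u => L.contDiff_logDensity u c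
    have hL1 : ∀ u, Differentiable ℝ (partialDeriv a (L.logDensity u c)) := fun u =>
      (ContDiff.partialDeriv (hL u) (k := 1) (by norm_num) a).differentiable (by simp)
    rw [e, partialDeriv_sub ((hL _).differentiable (by simp)) ((hL _).differentiable (by simp)),
      partialDeriv_sub (hL1 _) (hL1 _)]
    simp only [L.partialDeriv_partialDeriv_logDensity hab hadj, sub_zero]
  rw [partialDeriv_partialDeriv_comp hQ hkc,
    sum_sum_eq_diag_add _ (fun i j => M.markovNet.Adj (some i) (some j))] at hzero
  · rw [Fintype.sum_sum_type, Fintype.sum_sum_type, ← hzero, add_comm]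
    congr 1
    · congr 1
      · refine Finset.sum_congr rfl fun i _ => ?_
        simp only [mixedCoeff, Pi.sub_apply, wVec, hQ2]
      · refine Finset.sum_congr rfl fun e _ => ?_
        rw [partialDeriv_comm hQ e.1.2 e.1.1]
        simp only [mixedCoeff, Pi.sub_apply, wVec, hQ2]
        ring
    · refine Finset.sum_congr rfl fun i _ => ?_
      simp only [mixedCoeff, Pi.sub_apply, wVec, hQ1]
  -- Pairs that are not edges of `M` have no entry in `wVec`; their mixed derivatives vanish by
  -- conditional independence in `M`.
  · intro i j hij hnadj
    have h0 : partialDeriv j (partialDeriv i Q) (k x) = 0 := by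
      rw [hQ2, M.partialDeriv_partialDeriv_logDensity hij.ne hnadj,
        M.partialDeriv_partialDeriv_logDensity hij.ne hnadj, sub_zero]
    rw [← partialDeriv_comm hQ i j, h0]
    ring

theorem jac_mul_jac_eq_zero [NeZero C] (hobs : ObsEquiv M L) (hZ : M.SufficientChangesZ)
    {a b : Fin n} (hab : a ≠ b) (hadj : ¬ L.markovNet.Adj (some a) (some b)) (x : Fin n → ℝ)
    {i j : Fin n} (hij : i = j ∨ M.markovNet.Adj (some i) (some j)) :
    jac (transition L M) x i a * jac (transition L M) x j b = 0 := by
  have h0 := mixedCoeff_eq_zero hobs hZ hab hadj x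
  have hdiag : ∀ i, jac (transition L M) x i a * jac (transition L M) x i b = 0 := fun i => by
    have := congrFun h0 (.inr (.inl i))
    simp only [mixedCoeff, Pi.zero_apply] at this
    rw [mul_comm]; exact this
  rcases hij with rfl | hij
  · exact hdiag i
  have hsum : jac (transition L M) x i a * jac (transition L M) x j b +
      jac (transition L M) x j a * jac (transition L M) x i b = 0 := by
    have hne : i ≠ j := by
      rintro rfl
      exact hij.1 rfl
    rcases lt_or_gt_of_ne hne with hlt | hlt
    · have := congrFun h0 (.inr (.inr ⟨(i, j), hlt, hij⟩))
      simp only [mixedCoeff, Pi.zero_apply] at this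
      linarith
    · have := congrFun h0 (.inr (.inr ⟨(j, i), hlt, hij.symm⟩))
      simp only [mixedCoeff, Pi.zero_apply] at this
      linarith
  -- An edge only gives a vanishing sum of two products. The diagonal relation at `i` kills one
  -- factor: either the wanted product is zero at once, or the other product is.
  rcases mul_eq_zero.mp (hdiag i) with h | h
  · rw [h, zero_mul]
  · rw [h, mul_zero, add_zero] at hsum
    exact hsum

/-- The learned log-ratio of two labels does not depend on `ẑ_a`, and the true one has no derivative
outside the true blanket. The chain rule thus pairs column `a` of the Jacobian, on the blanket, with
the independent `tauVec` differences. -/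
theorem jac_eq_zero [NeZero C] (hobs : ObsEquiv M L) (hY : M.SufficientChangesY)
    {i a : Fin n} (hi : i ∈ M.blanket) (ha : a ∉ L.blanket) (x : Fin n → ℝ) :
    jac (transition L M) x i a = 0 := by
  classical
  obtain ⟨c₁, u, c, -, hli⟩ := hY (transition L M x)
  set k := transition L M with hk
  have h0 : (fun i : M.blanket => jac k x i.1 a) = 0 := by
    refine eq_zero_of_linearIndependent hli (by simp) fun m => ?_
    let Q : (Fin n → ℝ) → ℝ := fun z =>
      M.logDensity (u m) (c m) z - M.logDensity (u m) c₁ z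
    have hℓd : ∀ c, Differentiable ℝ (M.logDensity (u m) c) := fun c =>
      (M.contDiff_logDensity (u m) c).differentiable (by simp)
    have hQ1 : ∀ i z, partialDeriv i Q z = partialDeriv i (M.logDensity (u m) (c m)) z -
        partialDeriv i (M.logDensity (u m) c₁) z := fun i z =>
      congrFun (partialDeriv_sub (hℓd _) (hℓd _) i) z
    have e : (fun y => Q (k y)) = fun y =>
        L.logDensity (u m) (c m) y - L.logDensity (u m) c₁ y := by
      funext y
      exact (logDensity_sub_eq hobs _ _ _ _ y).symm
    have hzero := L.partialDeriv_logDensity_sub ha (u m) (c m) c₁ x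
    have hQd : Differentiable ℝ Q := (hℓd _).sub (hℓd _)
    have hkc : ContDiff ℝ 2 k := contDiff_two_transition hobs
    rw [← e, partialDeriv_comp hQd (hkc.differentiable (by simp))] at hzero
    rw [← hzero, ← Finset.sum_subset (Finset.subset_univ M.blanket)]
    · rw [← Finset.sum_coe_sort M.blanket]
      refine Finset.sum_congr rfl fun i _ => ?_
      rw [hQ1]
      rfl
    · intro i _ hi
      have : partialDeriv i Q (k x) = 0 := M.partialDeriv_logDensity_sub hi (u m) (c m) c₁ (k x)
      rw [this, zero_mul]
  exact congrFun h0 ⟨i, hi⟩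

theorem jac_mul_jac_transition (h : Set.range M.mix = Set.range L.mix) (x : Fin n → ℝ) :
    Matrix.of (jac (transition L M) x) *
      Matrix.of (jac (transition M L) (transition L M x)) = 1 := by
  classical
  have h1 : Differentiable ℝ (transition M L) := (contDiff_transition h).differentiable (by simp)
  have h2 : Differentiable ℝ (transition L M) :=
    (contDiff_transition h.symm).differentiable (by simp)
  rw [mul_eq_one_comm]
  ext i a
  simp only [Matrix.mul_apply, Matrix.of_apply]
  have h3 : Differentiable ℝ fun z => transition M L z i := differentiable_pi.mp h1 i
  have := partialDeriv_comp h3 h2 a x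
  simp only [transition_transition h.symm] at this
  have e : ∀ l, partialDeriv l (fun z => transition M L z i) (transition L M x) =
      jac (transition M L) (transition L M x) i l := fun l => rfl
  simp only [e] at this
  rw [← this, partialDeriv]
  have hf : HasFDerivAt (fun y : Fin n → ℝ => y i) (ContinuousLinearMap.proj i : _ →L[ℝ] ℝ) x :=
    (ContinuousLinearMap.proj i : (Fin n → ℝ) →L[ℝ] ℝ).hasFDerivAt
  rw [hf.fderiv]
  simp [Matrix.one_apply, Pi.single_apply]

end Model

end MBIdent

/-! ### From the zero pattern of the Jacobian to graph isomorphism and neighborhood inclusions. -/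

namespace MBIdent

section Combinatorics

open Matrix

/-- A nonzero determinant has a nonzero term in its Leibniz expansion. -/
theorem exists_perm_of_mul_eq_one {V : Type*} [Fintype V] [DecidableEq V] {A B : Matrix V V ℝ}
    (h : A * B = 1) : ∃ σ : Equiv.Perm V, ∀ a, A (σ a) a ≠ 0 := by
  have hdet : A.det ≠ 0 := by
    intro h0
    have := congrArg Matrix.det h
    rw [Matrix.det_mul, h0, zero_mul, Matrix.det_one] at this
    exact zero_ne_one this
  rw [Matrix.det_apply] at hdet
  obtain ⟨σ, -, hσ⟩ := Finset.exists_ne_zero_of_sum_ne_zero hdet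
  refine ⟨σ, fun a ha => hσ ?_⟩
  rw [Finset.prod_eq_zero (f := fun i => A (σ i) i) (Finset.mem_univ a) ha, smul_zero]

/-- The inverse of a matrix supported on a transitive and reflexive relation is supported on
it. -/
theorem rel_of_mul_eq_one {V : Type*} [Fintype V] [DecidableEq V] {A B : Matrix V V ℝ}
    (h : A * B = 1) {r : V → V → Prop} (hrefl : ∀ i, r i i)
    (htrans : ∀ i j k, r i j → r j k → r i k) (hA : ∀ i j, A i j ≠ 0 → r i j) {i j : V}
    (hB : B i j ≠ 0) : r i j := by
  -- Vectors supported on the predecessors of `j`. `A` maps `W` into itself injectively, hence onto,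
  -- so the preimage of the basis vector at `j`, which is column `j` of `B`, lies in `W`.
  let W : Submodule ℝ (V → ℝ) :=
    { carrier := {v | ∀ i, ¬ r i j → v i = 0}
      add_mem' := fun {v w} hv hw i hi => by simp [hv i hi, hw i hi]
      zero_mem' := fun i _ => rfl
      smul_mem' := fun c v hv i hi => by simp [hv i hi] }
  have hBA : B * A = 1 := mul_eq_one_comm.mp h
  have hmaps : ∀ v ∈ W, A.mulVecLin v ∈ W := by
    intro v hv i hi
    simp only [Matrix.mulVecLin_apply, Matrix.mulVec, dotProduct]
    refine Finset.sum_eq_zero fun l _ => ?_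
    by_cases hl : r l j
    · have : A i l = 0 := by
        by_contra hne
        exact hi (htrans _ _ _ (hA i l hne) hl)
      rw [this, zero_mul]
    · rw [hv l hl, mul_zero]
  let f : W →ₗ[ℝ] W := A.mulVecLin.restrict hmaps
  have hinj : Function.Injective f := by
    intro v w hvw
    have h1 : A *ᵥ v.1 = A *ᵥ w.1 := congrArg Subtype.val hvw
    have h2 := congrArg (B *ᵥ ·) h1
    simp only [Matrix.mulVec_mulVec, hBA, Matrix.one_mulVec] at h2
    exact Subtype.ext h2
  have hej : (Pi.single j 1 : V → ℝ) ∈ W := by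
    intro l hl
    rw [Pi.single_eq_of_ne]
    rintro rfl
    exact hl (hrefl _)
  obtain ⟨γ, hγ⟩ := LinearMap.injective_iff_surjective.mp hinj ⟨_, hej⟩
  have h1 : A *ᵥ γ.1 = Pi.single j 1 := congrArg Subtype.val hγ
  have h2 := congrArg (B *ᵥ ·) h1
  simp only [Matrix.mulVec_mulVec, hBA, Matrix.one_mulVec, Matrix.mulVec_single_one] at h2
  by_contra hr
  refine hB ?_
  have := γ.2 i hr
  rw [h2] at this
  exact this

/-- An injection of edges between graphs of which the second has no more edges is an
isomorphism. -/
theorem adj_iff_of_ncard_le {V : Type*} [Finite V] {G H : SimpleGraph V} (τ : Equiv.Perm V)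
    (hτ : ∀ a b, G.Adj a b → H.Adj (τ a) (τ b)) (hcard : H.edgeSet.ncard ≤ G.edgeSet.ncard)
    (a b : V) : G.Adj a b ↔ H.Adj (τ a) (τ b) := by
  have hle : G ≤ H.comap τ := fun a b h => hτ a b h
  have hiso : (H.comap τ).edgeSet.ncard = H.edgeSet.ncard := by
    rw [← Nat.card_coe_set_eq, ← Nat.card_coe_set_eq]
    exact Nat.card_congr (SimpleGraph.Iso.comap τ H).mapEdgeSet
  have heq : G.edgeSet = (H.comap τ).edgeSet :=
    Set.eq_of_subset_of_ncard_le (SimpleGraph.edgeSet_mono hle) (by rw [hiso]; exact hcard)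
      (Set.toFinite _)
  have : G = H.comap τ := SimpleGraph.edgeSet_injective heq
  constructor
  · exact hτ a b
  · intro h
    rw [this]
    exact h

/-- The closed neighborhood of a vertex. -/
def closedNbhd {V : Type*} (G : SimpleGraph V) (v : V) : Set V := {w | w = v ∨ G.Adj v w}

variable {n : ℕ} {G H : SimpleGraph (Node n)} {J K : Matrix (Fin n) (Fin n) ℝ}

/-- A permutation along which a matrix that separates non-adjacent vertices does not vanish is an
isomorphism of graphs. -/
theorem adj_iff_of_jacobian
    (h1 : ∀ a b, a ≠ b → ¬ H.Adj (some a) (some b) → ∀ i j,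
      (i = j ∨ G.Adj (some i) (some j)) → J i a * J j b = 0)
    (h2 : ∀ i a, G.Adj (some i) none → ¬ H.Adj (some a) none → J i a = 0)
    (hcard : H.edgeSet.ncard ≤ G.edgeSet.ncard) {σ : Equiv.Perm (Fin n)}
    (hσ : ∀ a, J (σ a) a ≠ 0) (v w : Node n) :
    G.Adj v w ↔ H.Adj (Equiv.optionCongr σ.symm v) (Equiv.optionCongr σ.symm w) := by
  have hσ' : ∀ i, J i (σ.symm i) ≠ 0 := fun i => by
    have := hσ (σ.symm i)
    rwa [Equiv.apply_symm_apply] at this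
  have hnone : ∀ i, G.Adj (some i) none → H.Adj (some (σ.symm i)) none := by
    intro i hi
    by_contra hc
    exact hσ' i (h2 i _ hi hc)
  refine adj_iff_of_ncard_le (Equiv.optionCongr σ.symm) (fun v w hvw => ?_) hcard v w
  cases v with
  | none =>
    cases w with
    | none => exact absurd hvw G.irrefl
    | some j => exact (hnone j hvw.symm).symm
  | some i =>
    cases w with
    | none => exact hnone i hvw
    | some j =>
      have hij : i ≠ j := by
        rintro rfl
        exact G.irrefl hvw
      by_contra hc
      exact mul_ne_zero (hσ' i) (hσ' j) (h1 _ _ (σ.symm.injective.ne hij) hc i j (Or.inr hvw))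

/-- Suppose `j` lies in the closed neighborhood of `i` but not in that of `σ a`. Through the
isomorphism, `a` and `σ⁻¹ j` are distinct and non-adjacent in `H`, so `J i a * J j (σ⁻¹ j) = 0`,
although both factors are nonzero. -/
theorem closedNbhd_subset_of_jacobian
    (h1 : ∀ a b, a ≠ b → ¬ H.Adj (some a) (some b) → ∀ i j,
      (i = j ∨ G.Adj (some i) (some j)) → J i a * J j b = 0)
    (h2 : ∀ i a, G.Adj (some i) none → ¬ H.Adj (some a) none → J i a = 0)
    (hcard : H.edgeSet.ncard ≤ G.edgeSet.ncard) {σ : Equiv.Perm (Fin n)}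
    (hσ : ∀ a, J (σ a) a ≠ 0) {i a : Fin n} (hia : J i a ≠ 0) :
    closedNbhd G (some i) ⊆ closedNbhd G (some (σ a)) := by
  have hiso := adj_iff_of_jacobian h1 h2 hcard hσ
  intro w hw
  cases w with
  | none =>
    have hw' : G.Adj (some i) none := hw.resolve_left (by simp)
    refine Or.inr ?_
    by_contra hc
    refine hia (h2 i a hw' fun hH => hc ?_)
    rw [hiso]
    have e : H.Adj (some (σ.symm (σ a))) none := by rwa [Equiv.symm_apply_apply]
    exact e
  | some j =>
    have hj : i = j ∨ G.Adj (some i) (some j) := by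
      rcases hw with hw | hw
      · exact Or.inl (by simpa using hw.symm)
      · exact Or.inr hw
    by_cases hja : j = σ a
    · exact Or.inl (by rw [hja])
    · refine Or.inr ?_
      by_contra hc
      have hne : a ≠ σ.symm j := by
        rintro rfl
        simp at hja
      refine mul_ne_zero hia ?_ (h1 a (σ.symm j) hne (fun hH => hc ?_) i j hj)
      · have := hσ (σ.symm j)
        rwa [Equiv.apply_symm_apply] at this
      · rw [hiso]
        have e : H.Adj (some (σ.symm (σ a))) (some (σ.symm j)) := by rwa [Equiv.symm_apply_apply]
        exact e

/-- After its columns are permuted by `σ`, `J` is supported on the preorder of inclusion of closed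
neighborhoods, hence so is its inverse. -/
theorem closedNbhd_subset_of_inverse
    (h1 : ∀ a b, a ≠ b → ¬ H.Adj (some a) (some b) → ∀ i j,
      (i = j ∨ G.Adj (some i) (some j)) → J i a * J j b = 0)
    (h2 : ∀ i a, G.Adj (some i) none → ¬ H.Adj (some a) none → J i a = 0)
    (hcard : H.edgeSet.ncard ≤ G.edgeSet.ncard) {σ : Equiv.Perm (Fin n)}
    (hσ : ∀ a, J (σ a) a ≠ 0) (hJK : J * K = 1) {i a : Fin n} (hai : K a i ≠ 0) :
    closedNbhd G (some (σ a)) ⊆ closedNbhd G (some i) := by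
  have hAB : J.submatrix id σ.symm * K.submatrix σ.symm id = 1 := by
    rw [Matrix.submatrix_mul_equiv, hJK, Matrix.submatrix_one _ Function.injective_id]
  refine rel_of_mul_eq_one hAB
    (r := fun i j => closedNbhd G (some i) ⊆ closedNbhd G (some j)) (fun _ => subset_rfl)
    (fun _ _ _ h h' => h.trans h') (fun i j hij => ?_) (i := σ a) (j := i) ?_
  · have := closedNbhd_subset_of_jacobian h1 h2 hcard hσ (i := i) (a := σ.symm j) hij
    rwa [Equiv.apply_symm_apply] at this
  · simpa using hai

end Combinatorics

/-! ### From vanishing partial derivatives to functions of fewer coordinates. -/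

section Dependence

variable {n : ℕ}

/-- A function whose partial derivatives outside `s` vanish depends only on the coordinates
in `s`. -/
theorem dependsOn_of_partialDeriv_eq_zero {f : (Fin n → ℝ) → ℝ} (hf : Differentiable ℝ f)
    {s : Set (Fin n)} (h : ∀ z, ∀ i ∉ s, partialDeriv i f z = 0) : DependsOn f s := by
  intro x y hxy
  -- Along this segment only coordinates outside `s` move, so `f` has zero derivative.
  let γ : ℝ → Fin n → ℝ := fun t => x + t • (y - x)
  have hγ : ∀ t, HasDerivAt γ (y - x) t := fun t => by
    have := ((hasDerivAt_id t).smul_const (y - x)).const_add x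
    rw [one_smul] at this
    exact this
  have hd : ∀ t, HasDerivAt (fun t => f (γ t)) 0 t := by
    intro t
    have h1 := (hf (γ t)).hasFDerivAt.comp_hasDerivAt t (hγ t)
    have h2 : fderiv ℝ f (γ t) (y - x) = 0 := by
      rw [fderiv_eq_sum_partialDeriv]
      refine Finset.sum_eq_zero fun i _ => ?_
      by_cases hi : i ∈ s
      · simp [hxy i hi]
      · rw [h _ i hi, zero_mul]
    rw [h2] at h1
    exact h1
  have := is_const_of_deriv_eq_zero (fun t => (hd t).differentiableAt) (fun t => (hd t).deriv) 0 1
  simpa [γ] using this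

/-- Extension by zero of a partial vector. -/
noncomputable def extendZero (s : Finset (Fin n)) (y : s → ℝ) (i : Fin n) : ℝ :=
  if h : i ∈ s then y ⟨i, h⟩ else 0

theorem contDiff_extendZero (s : Finset (Fin n)) : ContDiff ℝ ∞ (extendZero s) := by
  refine contDiff_pi.mpr fun i => ?_
  by_cases h : i ∈ s
  · simp only [extendZero, h, dif_pos]
    exact contDiff_apply ℝ ℝ _
  · simp only [extendZero, h, dif_neg, not_false_eq_true]
    exact contDiff_const

theorem extendZero_apply (s : Finset (Fin n)) (y : s → ℝ) (i : s) : extendZero s y i = y i := by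
  simp [extendZero]

/-- If the coordinates in `t` of `h` depend only on those in `s`, and conversely for the inverse,
then `h` induces a diffeomorphism between these coordinates. -/
theorem exists_equiv_of_dependsOn {h k : (Fin n → ℝ) → (Fin n → ℝ)} (hh : ContDiff ℝ ∞ h)
    (hk : ContDiff ℝ ∞ k) (hkh : ∀ z, k (h z) = z) (hhk : ∀ z, h (k z) = z)
    {s t : Finset (Fin n)} (hs : ∀ a ∈ t, DependsOn (fun z => h z a) (s : Set (Fin n)))
    (ht : ∀ i ∈ s, DependsOn (fun z => k z i) (t : Set (Fin n))) :
    ∃ Φ : (s → ℝ) ≃ (t → ℝ), ContDiff ℝ ∞ Φ ∧ ContDiff ℝ ∞ Φ.symm ∧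
      ∀ z, (fun a : t => h z a) = Φ (fun i : s => z i) := by
  have aux : ∀ {h k : (Fin n → ℝ) → (Fin n → ℝ)} {s t : Finset (Fin n)},
      (∀ z, k (h z) = z) → (∀ i ∈ s, DependsOn (fun z => k z i) (t : Set (Fin n))) →
      ∀ y : s → ℝ, (fun i : s => k (extendZero t fun a : t => h (extendZero s y) a) i) = y := by
    intro h k s t hkh ht y
    funext i
    have e := ht i i.2 (x := extendZero t fun a : t => h (extendZero s y) a)
      (y := h (extendZero s y)) (fun a ha => extendZero_apply t _ ⟨a, ha⟩)
    dsimp only at e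
    rw [e, hkh, extendZero_apply]
  -- The padding by zeros is immaterial, as the retained components do not depend on the padded
  -- coordinates.
  refine ⟨⟨fun y a => h (extendZero s y) a, fun y i => k (extendZero t y) i, aux hkh ht,
    aux hhk hs⟩, ?_, ?_, fun z => ?_⟩
  · exact contDiff_pi.mpr fun a => contDiff_pi.mp (hh.comp (contDiff_extendZero s)) a
  · exact contDiff_pi.mpr fun i => contDiff_pi.mp (hk.comp (contDiff_extendZero t)) i
  · funext a
    exact hs a a.2 fun i hi => (extendZero_apply s (fun i : s => z i) ⟨i, hi⟩).symm

end Dependence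

/-! ### A permutation valid at every point, and the theorem. -/

namespace Model

variable {n d C : ℕ} {U : Type*} {M L : Model n d C U}

theorem mem_intimate_of_closedNbhd_subset {i j : Fin n} (hij : i ≠ j)
    (h : closedNbhd M.markovNet (some j) ⊆ closedNbhd M.markovNet (some i)) :
    i ∈ M.intimate j := by
  have hadj : M.markovNet.Adj (some i) (some j) :=
    (h (Or.inl rfl)).resolve_left (by simpa using hij.symm)
  exact ⟨hadj, fun w hw hne => (h (Or.inr hw)).resolve_left hne⟩

theorem continuous_jac {k : (Fin n → ℝ) → (Fin n → ℝ)} (hk : ContDiff ℝ ∞ k) (i a : Fin n) :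
    Continuous fun x => jac k x i a :=
  (ContDiff.partialDeriv (k := 0) (contDiff_pi.mp hk i) (by simp) a).continuous

/-- The Jacobian argument yields a permutation at each point, without any continuity in the point.
What is locally constant is the family of closed neighborhoods it selects, and the inclusions need
no more than that. -/
theorem isLearned_identification [NeZero C] [Nonempty U] (hfaith : M.Faithful)
    (hZ : M.SufficientChangesZ) (hY : M.SufficientChangesY) (hL : IsLearned M L) :
    ∃ π : Equiv.Perm (Fin n),
      (∀ a b, M.markovNet.Adj a b ↔
        L.markovNet.Adj (Equiv.optionCongr π a) (Equiv.optionCongr π b)) ∧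
      (∀ x i a, jac (transition L M) x i a ≠ 0 →
        closedNbhd M.markovNet (some i) ⊆ closedNbhd M.markovNet (some (π.symm a))) ∧
      ∀ z a i, jac (transition M L) z a i ≠ 0 →
        closedNbhd M.markovNet (some (π.symm a)) ⊆ closedNbhd M.markovNet (some i) := by
  have hobs := hL.2.1
  -- The true model is itself one of the competitors in the minimization.
  have hcard : L.markovNet.edgeSet.ncard ≤ M.markovNet.edgeSet.ncard :=
    hL.2.2 M hfaith ⟨rfl, fun _ => rfl⟩
  let J : (Fin n → ℝ) → Matrix (Fin n) (Fin n) ℝ := fun x => Matrix.of (jac (transition L M) x)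
  let K : (Fin n → ℝ) → Matrix (Fin n) (Fin n) ℝ := fun x =>
    Matrix.of (jac (transition M L) (transition L M x))
  have hJK : ∀ x, J x * K x = 1 := fun x => jac_mul_jac_transition hobs.1 x
  have h1 : ∀ x a b, a ≠ b → ¬ L.markovNet.Adj (some a) (some b) → ∀ i j,
      (i = j ∨ M.markovNet.Adj (some i) (some j)) → J x i a * J x j b = 0 :=
    fun x a b hab hadj i j hij => jac_mul_jac_eq_zero hobs hZ hab hadj x hij
  have h2 : ∀ x i a, M.markovNet.Adj (some i) none → ¬ L.markovNet.Adj (some a) none →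
      J x i a = 0 := fun x i a hi ha =>
    jac_eq_zero hobs hY (M.mem_blanket_of_adj hi)
      (fun hb => ha (L.adj_of_mem_blanket hL.1 hb)) x
  choose σ hσ using fun x => exists_perm_of_mul_eq_one (hJK x)
  have hloc : IsLocallyConstant fun x a => closedNbhd M.markovNet (some (σ x a)) := by
    rw [IsLocallyConstant.iff_eventually_eq]
    intro x
    -- Near `x` the permutation `σ x` still avoids the zeros of the Jacobian. Comparing it with `σ
    -- y` at `y` gives inclusions both ways.
    have hev : ∀ᶠ y in nhds x, ∀ a, J y (σ x a) a ≠ 0 := by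
      rw [Filter.eventually_all]
      intro a
      exact (continuous_jac (contDiff_transition hobs.1.symm) (σ x a) a).continuousAt.eventually_ne
        (hσ x a)
    filter_upwards [hev] with y hy
    funext a
    exact (closedNbhd_subset_of_jacobian (h1 y) (h2 y) hcard hy (hσ y a)).antisymm
      (closedNbhd_subset_of_jacobian (h1 y) (h2 y) hcard (hσ y) (hy a))
  have hconst : ∀ x a, closedNbhd M.markovNet (some (σ x a)) =
      closedNbhd M.markovNet (some (σ 0 a)) := fun x a =>
    congrFun (hloc.apply_eq_of_isPreconnected isPreconnected_univ (Set.mem_univ x)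
      (Set.mem_univ 0)) a
  -- The base point `0` is arbitrary.
  refine ⟨(σ 0).symm, adj_iff_of_jacobian (h1 0) (h2 0) hcard (hσ 0), fun x i a hia => ?_,
    fun z a i hai => ?_⟩
  · rw [Equiv.symm_symm, ← hconst x]
    exact closedNbhd_subset_of_jacobian (h1 x) (h2 x) hcard (hσ x) hia
  · rw [Equiv.symm_symm, ← hconst (transition M L z)]
    refine closedNbhd_subset_of_inverse (h1 _) (h2 _) hcard (hσ _) (hJK _) ?_
    simpa [K, transition_transition hobs.1] using hai

end Model

end MBIdent

theorem theorem1 {n d C : ℕ} {U : Type*} (M L : MBIdent.Model n d C U)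
    (hfaith : M.Faithful) (hZ : M.SufficientChangesZ) (hY : M.SufficientChangesY)
    (hL : MBIdent.Model.IsLearned M L) :
    ∃ π : Equiv.Perm (Fin n),
      (∀ a b, M.markovNet.Adj a b ↔
        L.markovNet.Adj (Equiv.optionCongr π a) (Equiv.optionCongr π b)) ∧
      (∀ i, i ∈ M.blanket ↔ π i ∈ L.blanket) ∧
      (∀ i, ∃ h : (({i} ∪ M.intimate i : Set (Fin n)) → ℝ) → ℝ,
        ∀ z zhat : Fin n → ℝ, L.mix zhat = M.mix z →
          zhat (π i) = h (fun j => z j)) ∧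
      ∃ Φ : (M.blanket → ℝ) ≃ (L.blanket → ℝ),
        ContDiff ℝ ∞ Φ ∧ ContDiff ℝ ∞ Φ.symm ∧
        ∀ z zhat : Fin n → ℝ, L.mix zhat = M.mix z →
          (fun k : L.blanket => zhat k) = Φ (fun i : M.blanket => z i) := by
  -- Sufficient changes provide a label and, even for `n = 0`, the domain `u 0`; so `C ≠ 0` and `U`
  -- is nonempty.
  obtain ⟨c, u, -⟩ := hZ 0
  have : NeZero C := ⟨by rintro rfl; exact c.elim0⟩
  have : Nonempty U := ⟨u 0⟩
  have hobs := hL.2.1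
  obtain ⟨π, hiso, hJ, hK⟩ := MBIdent.Model.isLearned_identification hfaith hZ hY hL
  have hsM := MBIdent.Model.contDiff_transition hobs.1
  have hsL := MBIdent.Model.contDiff_transition hobs.1.symm
  have hdM : ∀ a, Differentiable ℝ fun z => MBIdent.Model.transition M L z a := fun a =>
    differentiable_pi.mp (hsM.differentiable (by simp)) a
  have hdL : ∀ i, Differentiable ℝ fun z => MBIdent.Model.transition L M z i := fun i =>
    differentiable_pi.mp (hsL.differentiable (by simp)) i
  have hzhat : ∀ z zhat : Fin n → ℝ, L.mix zhat = M.mix z →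
      zhat = MBIdent.Model.transition M L z := fun z zhat h =>
    L.mix_smooth.injective (h.trans (MBIdent.Model.mix_transition hobs.1 z).symm)
  have hblanket : ∀ i, i ∈ M.blanket ↔ π i ∈ L.blanket := fun i => by
    rw [M.mem_blanket_iff hfaith, L.mem_blanket_iff hL.1, hiso]
    exact Iff.rfl
  have hnbhd : ∀ i, i ∈ M.blanket ↔ none ∈ MBIdent.closedNbhd M.markovNet (some i) := fun i => by
    rw [M.mem_blanket_iff hfaith]
    exact ⟨Or.inr, fun h => h.resolve_left (by simp)⟩
  refine ⟨π, hiso, hblanket, fun i => ?_, ?_⟩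
  · have hdep : DependsOn (fun z => MBIdent.Model.transition M L z (π i))
        ({i} ∪ M.intimate i : Set (Fin n)) := by
      refine MBIdent.dependsOn_of_partialDeriv_eq_zero (hdM (π i)) fun z j hj => ?_
      by_contra hne
      have hsub := hK z (π i) j hne
      rw [Equiv.symm_apply_apply] at hsub
      refine hj ?_
      by_cases hji : j = i
      · exact Or.inl hji
      · exact Or.inr (MBIdent.Model.mem_intimate_of_closedNbhd_subset hji hsub)
    obtain ⟨h, hh⟩ := dependsOn_iff_exists_comp.mp hdep
    refine ⟨h, fun z zhat hz => ?_⟩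
    rw [hzhat z zhat hz]
    exact congrFun hh z
  · have hs : ∀ a ∈ L.blanket,
        DependsOn (fun z => MBIdent.Model.transition M L z a) (M.blanket : Set (Fin n)) := by
      intro a ha
      refine MBIdent.dependsOn_of_partialDeriv_eq_zero (hdM a) fun z j hj => ?_
      by_contra hne
      -- Blanket membership means that the label lies in the closed neighborhood, so it passes along
      -- the inclusion given by `hK`.
      refine hj ((hnbhd j).mpr (hK z a j hne ((hnbhd _).mp ((hblanket _).mpr ?_))))
      rwa [Equiv.apply_symm_apply]
    have ht : ∀ i ∈ M.blanket,
        DependsOn (fun x => MBIdent.Model.transition L M x i) (L.blanket : Set (Fin n)) := by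
      intro i hi
      refine MBIdent.dependsOn_of_partialDeriv_eq_zero (hdL i) fun x a ha => ?_
      by_contra hne
      refine ha ?_
      have := (hblanket _).mp ((hnbhd _).mpr (hJ x i a hne ((hnbhd i).mp hi)))
      rwa [Equiv.apply_symm_apply] at this
    obtain ⟨Φ, h1, h2, h3⟩ := MBIdent.exists_equiv_of_dependsOn hsM hsL
      (MBIdent.Model.transition_transition hobs.1)
      (MBIdent.Model.transition_transition hobs.1.symm) hs ht
    refine ⟨Φ, h1, h2, fun z zhat hz => ?_⟩
    rw [hzhat z zhat hz]
    exact h3 z
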